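/- For $n\ge 1$ let $\mathfrak{nil}_n$ be the Lie ring of strictly upper-triangular integral $n\times n$ matrices, with basis the matrix units $e_{ab}$ $(1\le a<b\le n)$, and let $C_*=\Lambda^*\mathfrak{nil}_n$ be its Chevalley--Eilenberg complex, with boundary $$\partial(x_1\wedge\dots\wedge x_k)=\sum_{i<j}(-1)^{i+j}[x_i,x_j]\wedge x_1\wedge\dots\widehat{x_i}\dots\widehat{x_j}\dots\wedge x_k,$$ so that $H_*(\mathfrak{nil}_n;\mathbb Z)=H_*(C_*)$. For $w\in\mathbb Z^n$ let $[[w]]=[[w_1,\dots,w_n]]\subseteq C_*$ be the subcomplex spanned by the wedges $e_{a_1b_1}\wedge\dots\wedge e_{a_kb_k}$ such that for all $i\in\{1,\dots,n\}$ $$w_i=i-|\{m:\,b_m=i\}|+|\{m:\,a_m=i\}|.$$ Let $q=p^m$ ($p$ prime, $m\ge 1$) be a prime power with $q\le n-2$, and let $$w=(2,3,\dots,q+1,\,2,\,q+1,\,q+3,\dots,n)$$ (the last block is empty if $q=n-2$). Then $[[w]]$ is a direct summand of the chain complex $C_*$, $$H_k[[w]]\cong\begin{cases}\mathbb Z/q,&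 k=q,\\ 0,& k\ne q.\end{cases}$$ Consequently, $H_q(\mathfrak{nil}_n;\mathbb Z)$ has a direct summand isomorphic to $\mathbb Z/q$; in particular $H_*(\mathfrak{nil}_n;\mathbb Z)$ contains $\mathbb Z_q$-torsion for every prime power $q\le n-2$. -/

import Mathlib

open CategoryTheory

/-! ## The Chevalley–Eilenberg complex of a Lie algebra (trivial coefficients) -/

universe u v

namespace LieHomology

section General

/-- Recursion step for `adAction`: `(y, (a, b)) ↦ ⁅x, y⁆ ∧ a + y ∧ b`. -/
noncomputable def adStep (R : Type*) {L : Type*} [CommRing R] [LieRing L] [LieAlgebra R L] (x : L) :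
    L →ₗ[R] ExteriorAlgebra R L × ExteriorAlgebra R L →ₗ[R] ExteriorAlgebra R L :=
  LinearMap.mk₂ R (fun y p => ExteriorAlgebra.ι R ⁅x, y⁆ * p.1 + ExteriorAlgebra.ι R y * p.2)
    (fun y z p => by simp only [lie_add, map_add, add_mul]; abel)
    (fun c y p => by simp only [lie_smul, map_smul, smul_mul_assoc, smul_add])
    (fun y p p' => by simp only [Prod.fst_add, Prod.snd_add, mul_add]; abel)
    (fun c y p => by simp only [Prod.smul_fst, Prod.smul_snd, mul_smul_comm, smul_add])

variable {R L : Type*} [CommRing R] [LieRing L] [LieAlgebra R L]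

theorem adStep_adStep (x y : L) (a c : ExteriorAlgebra R L) :
    adStep R x y (ExteriorAlgebra.ι R y * a, adStep R x y (a, c))
      = (0 : QuadraticForm R L) y • c := by
  have h1 : ExteriorAlgebra.ι R ⁅x, y⁆ * (ExteriorAlgebra.ι R y * a)
      + ExteriorAlgebra.ι R y * (ExteriorAlgebra.ι R ⁅x, y⁆ * a) = 0 := by
    rw [← mul_assoc, ← mul_assoc, ← add_mul, ExteriorAlgebra.ι_add_mul_swap, zero_mul]
  have h2 : ExteriorAlgebra.ι R y * (ExteriorAlgebra.ι R y * c) = 0 := by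
    rw [← mul_assoc, ExteriorAlgebra.ι_sq_zero, zero_mul]
  change ExteriorAlgebra.ι R ⁅x, y⁆ * (ExteriorAlgebra.ι R y * a)
    + ExteriorAlgebra.ι R y * (ExteriorAlgebra.ι R ⁅x, y⁆ * a + ExteriorAlgebra.ι R y * c) = _
  rw [mul_add, ← add_assoc, h1, h2]
  simp

/-- The derivation of the exterior algebra of `L` that extends `⁅x, ·⁆`, for one `x`;
see `adAction_one`, `adAction_ι_mul`. -/
noncomputable def adActionAux (R : Type*) {L : Type*} [CommRing R] [LieRing L] [LieAlgebra R L]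
    (x : L) : ExteriorAlgebra R L →ₗ[R] ExteriorAlgebra R L :=
  CliffordAlgebra.foldr' (0 : QuadraticForm R L) (adStep R x) (adStep_adStep x) 0

theorem adActionAux_algebraMap (x : L) (r : R) :
    adActionAux R x (algebraMap R (ExteriorAlgebra R L) r) = 0 :=
  (CliffordAlgebra.foldr'_algebraMap (0 : QuadraticForm R L) (adStep R x)
    (adStep_adStep x) 0 r).trans (smul_zero r)

theorem adActionAux_ι_mul (x y : L) (a : ExteriorAlgebra R L) :
    adActionAux R x (ExteriorAlgebra.ι R y * a)
      = ExteriorAlgebra.ι R ⁅x, y⁆ * a + ExteriorAlgebra.ι R y * adActionAux R x a :=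
  CliffordAlgebra.foldr'_ι_mul (0 : QuadraticForm R L) (adStep R x) (adStep_adStep x) 0 y a

/-- Left induction on the exterior algebra. -/
theorem wedge_induction {P : ExteriorAlgebra R L → Prop}
    (h0 : ∀ r : R, P (algebraMap R _ r)) (hadd : ∀ a b, P a → P b → P (a + b))
    (hmul : ∀ (x : L) (a : ExteriorAlgebra R L), P a → P (ExteriorAlgebra.ι R x * a))
    (a : ExteriorAlgebra R L) : P a :=
  CliffordAlgebra.left_induction (Q := (0 : QuadraticForm R L)) h0 hadd
    (fun a x ha => hmul x a ha) a

/-- The adjoint action of `L` on its exterior algebra, by derivations. -/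
noncomputable def adAction (R : Type*) {L : Type*} [CommRing R] [LieRing L] [LieAlgebra R L] :
    L →ₗ[R] ExteriorAlgebra R L →ₗ[R] ExteriorAlgebra R L where
  toFun x := adActionAux R x
  map_add' x y := by
    refine LinearMap.ext fun a => ?_
    induction a using wedge_induction with
    | h0 r => simp [adActionAux_algebraMap]
    | hadd a b ha hb => rw [map_add, map_add, ha, hb]
    | hmul z a ha =>
      rw [LinearMap.add_apply] at ha ⊢
      simp only [adActionAux_ι_mul, ha, add_lie, map_add, add_mul, mul_add]
      abel
  map_smul' c x := by
    refine LinearMap.ext fun a => ?_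
    induction a using wedge_induction with
    | h0 r => simp [adActionAux_algebraMap]
    | hadd a b ha hb => rw [map_add, map_add, ha, hb]
    | hmul z a ha =>
      simp only [RingHom.id_apply, LinearMap.smul_apply] at ha ⊢
      simp only [adActionAux_ι_mul, ha, smul_lie, map_smul, smul_mul_assoc, mul_smul_comm, smul_add]

theorem adAction_algebraMap (x : L) (r : R) :
    adAction R x (algebraMap R (ExteriorAlgebra R L) r) = 0 :=
  adActionAux_algebraMap x r

theorem adAction_one (x : L) : adAction R x (1 : ExteriorAlgebra R L) = 0 := by
  simpa using adAction_algebraMap (R := R) x 1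

theorem adAction_ι_mul (x y : L) (a : ExteriorAlgebra R L) :
    adAction R x (ExteriorAlgebra.ι R y * a)
      = ExteriorAlgebra.ι R ⁅x, y⁆ * a + ExteriorAlgebra.ι R y * adAction R x a :=
  adActionAux_ι_mul x y a

theorem adAction_lie (x y : L) (a : ExteriorAlgebra R L) :
    adAction R ⁅x, y⁆ a = adAction R x (adAction R y a) - adAction R y (adAction R x a) := by
  induction a using wedge_induction with
  | h0 r => simp [adAction_algebraMap]
  | hadd a b ha hb => simp only [map_add, ha, hb]; abel
  | hmul z a ha =>
    simp only [adAction_ι_mul, map_add, ha, mul_sub, lie_lie, map_sub, sub_mul]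
    abel

/-- Recursion step for `boundary`: `(x, (a, b)) ↦ -(ad x (a) + x ∧ b)`. -/
noncomputable def boundaryStep (R L : Type*) [CommRing R] [LieRing L] [LieAlgebra R L] :
    L →ₗ[R] ExteriorAlgebra R L × ExteriorAlgebra R L →ₗ[R] ExteriorAlgebra R L :=
  LinearMap.mk₂ R (fun x p => -(adAction R x p.1 + ExteriorAlgebra.ι R x * p.2))
    (fun x y p => by simp only [map_add, LinearMap.add_apply, add_mul]; abel)
    (fun c x p => by
      simp only [map_smul, LinearMap.smul_apply, smul_mul_assoc, smul_add, smul_neg])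
    (fun x p p' => by simp only [Prod.fst_add, Prod.snd_add, map_add, mul_add]; abel)
    (fun c x p => by
      simp only [Prod.smul_fst, Prod.smul_snd, map_smul, mul_smul_comm, smul_add, smul_neg])

theorem boundaryStep_boundaryStep (x : L) (a c : ExteriorAlgebra R L) :
    boundaryStep R L x (ExteriorAlgebra.ι R x * a, boundaryStep R L x (a, c))
      = (0 : QuadraticForm R L) x • c := by
  have h2 : ExteriorAlgebra.ι R x * (ExteriorAlgebra.ι R x * c) = 0 := by
    rw [← mul_assoc, ExteriorAlgebra.ι_sq_zero, zero_mul]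
  change -(adAction R x (ExteriorAlgebra.ι R x * a)
    + ExteriorAlgebra.ι R x * -(adAction R x a + ExteriorAlgebra.ι R x * c)) = _
  rw [adAction_ι_mul, lie_self, map_zero, zero_mul, mul_neg, mul_add, h2]
  simp

/-- The Chevalley–Eilenberg boundary on the exterior algebra of `L`. It is defined by recursion,
`∂ 1 = 0` and `∂ (x ∧ a) = -(ad x (a) + x ∧ ∂ a)`; the usual closed formula
`∂ (x₁ ∧ ⋯ ∧ xₖ) = ∑_{i < j} (-1)^(i+j) ⁅xᵢ, xⱼ⁆ ∧ x₁ ∧ ⋯ x̂ᵢ ⋯ x̂ⱼ ⋯ ∧ xₖ`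
is proved below as `boundary_wedge`. -/
noncomputable def boundary (R L : Type*) [CommRing R] [LieRing L] [LieAlgebra R L] :
    ExteriorAlgebra R L →ₗ[R] ExteriorAlgebra R L :=
  CliffordAlgebra.foldr' (0 : QuadraticForm R L) (boundaryStep R L) boundaryStep_boundaryStep 0

theorem boundary_algebraMap (r : R) :
    boundary R L (algebraMap R (ExteriorAlgebra R L) r) = 0 :=
  (CliffordAlgebra.foldr'_algebraMap (0 : QuadraticForm R L) (boundaryStep R L)
    boundaryStep_boundaryStep 0 r).trans (smul_zero r)

theorem boundary_one : boundary R L 1 = 0 := by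
  simpa using boundary_algebraMap (R := R) (L := L) 1

theorem boundary_ι_mul (x : L) (a : ExteriorAlgebra R L) :
    boundary R L (ExteriorAlgebra.ι R x * a)
      = -(adAction R x a + ExteriorAlgebra.ι R x * boundary R L a) :=
  CliffordAlgebra.foldr'_ι_mul (0 : QuadraticForm R L) (boundaryStep R L)
    boundaryStep_boundaryStep 0 x a

theorem boundary_adAction (x : L) (a : ExteriorAlgebra R L) :
    boundary R L (adAction R x a) = adAction R x (boundary R L a) := by
  induction a using wedge_induction with
  | h0 r => simp [adAction_algebraMap, boundary_algebraMap]
  | hadd a b ha hb => simp only [map_add, ha, hb]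
  | hmul y a ha =>
    simp only [adAction_ι_mul, boundary_ι_mul, map_add, map_neg, ha, adAction_lie]
    abel

theorem boundary_boundary (a : ExteriorAlgebra R L) :
    boundary R L (boundary R L a) = 0 := by
  induction a using wedge_induction with
  | h0 r => simp [boundary_algebraMap]
  | hadd a b ha hb => simp only [map_add, ha, hb, add_zero]
  | hmul x a ha =>
    simp only [boundary_ι_mul, map_add, map_neg, boundary_adAction, ha]
    simp

/-- The ordered wedge of the entries of `x` whose position is neither `i` nor `j`. -/
noncomputable def wedgeOmit (R : Type*) {L : Type*} [CommRing R] [LieRing L] [LieAlgebra R L]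
    {k : ℕ} (x : Fin k → L) (i j : Fin k) : ExteriorAlgebra R L :=
  (((List.finRange k).filter (fun m => m ≠ i ∧ m ≠ j)).map
    (fun m => ExteriorAlgebra.ι R (x m))).prod

theorem ιMulti_succ' {k : ℕ} (x : Fin (k + 1) → L) :
    ExteriorAlgebra.ιMulti R (k + 1) x
      = ExteriorAlgebra.ι R (x 0) * ExteriorAlgebra.ιMulti R k (fun m => x m.succ) :=
  ExteriorAlgebra.ιMulti_succ_apply x

theorem wedgeOmit_succ_succ {k : ℕ} (x : Fin (k + 1) → L) (i j : Fin k) :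
    wedgeOmit R x i.succ j.succ
      = ExteriorAlgebra.ι R (x 0) * wedgeOmit R (fun m => x m.succ) i j := by
  unfold wedgeOmit
  rw [List.finRange_succ, List.filter_cons_of_pos (by simp [(Fin.succ_ne_zero _).symm]),
    List.map_cons, List.prod_cons, List.filter_map, List.map_map]
  congr 4
  ext m
  simp

theorem wedgeOmit_zero_succ {k : ℕ} (x : Fin (k + 1) → L) (j : Fin k) :
    wedgeOmit R x 0 j.succ = wedgeOmit R (fun m => x m.succ) j j := by
  unfold wedgeOmit
  rw [List.finRange_succ, List.filter_cons_of_neg (by simp), List.filter_map, List.map_map]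
  congr 3
  ext m
  simp

theorem wedgeOmit_zero_zero {k : ℕ} (x : Fin (k + 1) → L) :
    wedgeOmit R x 0 0 = ExteriorAlgebra.ιMulti R k (fun m => x m.succ) := by
  unfold wedgeOmit
  rw [List.finRange_succ, List.filter_cons_of_neg (by simp), List.filter_map, List.map_map,
    ExteriorAlgebra.ιMulti_apply, List.ofFn_eq_map, List.filter_eq_self.2 (by simp)]
  rfl

theorem ι_mul_ι_mul (x y : L) (a : ExteriorAlgebra R L) :
    ExteriorAlgebra.ι R x * (ExteriorAlgebra.ι R y * a)
      = -(ExteriorAlgebra.ι R y * (ExteriorAlgebra.ι R x * a)) := by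
  rw [eq_neg_iff_add_eq_zero, ← mul_assoc, ← mul_assoc, ← add_mul,
    ExteriorAlgebra.ι_add_mul_swap, zero_mul]

theorem adAction_wedge (y : L) {k : ℕ} (x : Fin k → L) :
    adAction R y (ExteriorAlgebra.ιMulti R k x)
      = ∑ j : Fin k, (-1 : ℤ) ^ (j : ℕ) •
          (ExteriorAlgebra.ι R ⁅y, x j⁆ * wedgeOmit R x j j) := by
  induction k with
  | zero => simp [adAction_one]
  | succ k ih =>
    rw [ιMulti_succ', adAction_ι_mul, ih, Fin.sum_univ_succ, wedgeOmit_zero_zero, Finset.mul_sum]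
    congr 1
    · simp
    · refine Finset.sum_congr rfl fun j _ => ?_
      rw [wedgeOmit_succ_succ, ι_mul_ι_mul ⁅y, x j.succ⁆, Fin.val_succ, pow_succ, mul_smul_comm]
      simp

/-- The closed formula for the Chevalley–Eilenberg boundary. -/
theorem boundary_wedge {k : ℕ} (x : Fin k → L) :
    boundary R L (ExteriorAlgebra.ιMulti R k x)
      = ∑ i : Fin k, ∑ j ∈ Finset.Ioi i, (-1 : ℤ) ^ ((i : ℕ) + (j : ℕ)) •
          (ExteriorAlgebra.ι R ⁅x i, x j⁆ * wedgeOmit R x i j) := by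
  induction k with
  | zero => simp [boundary_one]
  | succ k ih =>
    rw [ιMulti_succ', boundary_ι_mul, ih, adAction_wedge, Fin.sum_univ_succ, neg_add]
    congr 1
    · rw [Fin.Ioi_zero_eq_map, Finset.sum_map, ← Finset.sum_neg_distrib]
      refine Finset.sum_congr rfl fun j _ => ?_
      simp [wedgeOmit_zero_succ, pow_succ]
    · rw [Finset.mul_sum, ← Finset.sum_neg_distrib]
      refine Finset.sum_congr rfl fun i _ => ?_
      rw [Finset.mul_sum, ← Finset.sum_neg_distrib, Fin.Ioi_succ, Finset.sum_map]
      refine Finset.sum_congr rfl fun j _ => ?_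
      simp only [Fin.coe_succEmb, Fin.val_succ]
      rw [wedgeOmit_succ_succ, ι_mul_ι_mul ⁅x i.succ, x j.succ⁆, mul_smul_comm, smul_neg]
      congr 2
      ring

/-- The chain complex with modules `C k` and the restriction of the Chevalley–Eilenberg boundary,
for submodules `C k` of the exterior algebra that are compatible with the boundary. -/
noncomputable def complexOf {R : Type u} {L : Type v} [CommRing R] [LieRing L] [LieAlgebra R L]
    (C : ℕ → Submodule R (ExteriorAlgebra R L))
    (hC : ∀ k, ∀ a ∈ C (k + 1), boundary R L a ∈ C k) :
    ChainComplex (ModuleCat.{max u v} R) ℕ :=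
  ChainComplex.of (fun k => ModuleCat.of R (C k))
    (fun k => ModuleCat.ofHom ((boundary R L).restrict (hC k)))
    (fun _ => ModuleCat.hom_ext (LinearMap.ext fun a =>
      Subtype.ext (boundary_boundary (a : ExteriorAlgebra R L))))

/-- The inclusion of chain complexes given by submodules `C k ≤ D k`. -/
noncomputable def complexIncl {R : Type u} {L : Type v} [CommRing R] [LieRing L] [LieAlgebra R L]
    {C D : ℕ → Submodule R (ExteriorAlgebra R L)}
    (hC : ∀ k, ∀ a ∈ C (k + 1), boundary R L a ∈ C k)
    (hD : ∀ k, ∀ a ∈ D (k + 1), boundary R L a ∈ D k) (h : ∀ k, C k ≤ D k) :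
    complexOf C hC ⟶ complexOf D hD :=
  ChainComplex.ofHom (X := complexOf C hC) (Y := complexOf D hD)
    (fun k => ModuleCat.ofHom (Submodule.inclusion (h k)))
    (fun k => by
      unfold complexOf
      dsimp only [ChainComplex.of]
      rw [ChainComplex.of_d, ChainComplex.of_d]
      rfl)

theorem ι_mul_mem_exteriorPower {k : ℕ} (x : L) {a : ExteriorAlgebra R L}
    (ha : a ∈ ⋀[R]^k L) : ExteriorAlgebra.ι R x * a ∈ ⋀[R]^(k + 1) L := by
  rw [ExteriorAlgebra.exteriorPower, pow_succ']
  exact Submodule.mul_mem_mul (LinearMap.mem_range_self _ x) ha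

theorem adAction_mem_exteriorPower {k : ℕ} (y : L) {a : ExteriorAlgebra R L}
    (ha : a ∈ ⋀[R]^k L) : adAction R y a ∈ ⋀[R]^k L := by
  rw [← ExteriorAlgebra.ιMulti_span_fixedDegree] at ha
  induction ha using Submodule.span_induction with
  | zero => simp
  | add a b _ _ ha hb => rw [map_add]; exact add_mem ha hb
  | smul c a _ ha => rw [map_smul]; exact Submodule.smul_mem _ c ha
  | mem a ha =>
    obtain ⟨x, rfl⟩ := ha
    induction k with
    | zero => simp [adAction_one]
    | succ k ih =>
      rw [ιMulti_succ', adAction_ι_mul]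
      exact add_mem
        (ι_mul_mem_exteriorPower _ (ExteriorAlgebra.ιMulti_range R k ⟨_, rfl⟩))
        (ι_mul_mem_exteriorPower _ (ih _))

theorem boundary_mem_exteriorPower (k : ℕ) (a : ExteriorAlgebra R L)
    (ha : a ∈ ⋀[R]^(k + 1) L) : boundary R L a ∈ ⋀[R]^k L := by
  rw [← ExteriorAlgebra.ιMulti_span_fixedDegree] at ha
  induction ha using Submodule.span_induction with
  | zero => simp
  | add a b _ _ ha hb => rw [map_add]; exact add_mem ha hb
  | smul c a _ ha => rw [map_smul]; exact Submodule.smul_mem _ c ha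
  | mem a ha =>
    obtain ⟨x, rfl⟩ := ha
    induction k with
    | zero =>
      rw [ιMulti_succ', boundary_ι_mul, ExteriorAlgebra.ιMulti_zero_apply, adAction_one,
        boundary_one, mul_zero, add_zero, neg_zero]
      exact zero_mem _
    | succ k ih =>
      rw [ιMulti_succ', boundary_ι_mul]
      exact neg_mem (add_mem
        (adAction_mem_exteriorPower _ (ExteriorAlgebra.ιMulti_range R _ ⟨_, rfl⟩))
        (ι_mul_mem_exteriorPower _ (ih _)))

/-- The Chevalley–Eilenberg complex `⋀^* L` with trivial coefficients; its homology is
`H_*(L; R)` when `L` is free over `R`. -/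
noncomputable def chevalleyEilenberg (R : Type u) (L : Type v) [CommRing R] [LieRing L]
    [LieAlgebra R L] : ChainComplex (ModuleCat.{max u v} R) ℕ :=
  complexOf (fun k => ⋀[R]^k L) boundary_mem_exteriorPower

end General

/-! ## Strictly upper triangular integral matrices -/

section Nil

attribute [local instance] LieRing.ofAssociativeRing

/-- The Lie ring `nil_n` of strictly upper triangular integral `n × n` matrices. -/
def nil (n : ℕ) : LieSubalgebra ℤ (Matrix (Fin n) (Fin n) ℤ) where
  carrier := {A | ∀ i j, j ≤ i → A i j = 0}
  zero_mem' := fun _ _ _ => rfl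
  add_mem' := fun {A B} hA hB i j h => by simp [hA i j h, hB i j h]
  smul_mem' := fun c A hA i j h => by simp [hA i j h]
  lie_mem' := fun {A B} hA hB i j h => by
    have key : ∀ X Y : Matrix (Fin n) (Fin n) ℤ, (∀ i j, j ≤ i → X i j = 0) →
        (∀ i j, j ≤ i → Y i j = 0) → (X * Y) i j = 0 := by
      intro X Y hX hY
      rw [Matrix.mul_apply]
      refine Finset.sum_eq_zero fun m _ => ?_
      rcases le_total m i with hm | hm
      · rw [hX i m hm, zero_mul]
      · rw [hY m j (h.trans hm), mul_zero]
    rw [Ring.lie_def, Matrix.sub_apply, key A B hA hB, key B A hB hA, sub_zero]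

/-- The positions `(a, b)` with `a < b`, which index the basis `e_{ab}` of `nil_n`. -/
abbrev Pos (n : ℕ) : Type := {p : Fin n × Fin n // p.1 < p.2}

/-- The matrix unit `e_{ab}`. -/
def e {n : ℕ} (p : Pos n) : nil n :=
  ⟨Matrix.single p.1.1 p.1.2 1, fun i j h => by
    rw [Matrix.single_apply]
    refine if_neg ?_
    rintro ⟨rfl, rfl⟩
    exact absurd p.2 (not_lt.2 h)⟩

/-- The weight of the wedge `e_{a₁b₁} ∧ ⋯ ∧ e_{aₖbₖ}`: the number of times that `i` appears on the
right minus the number of times that it appears on the left. -/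
def weight {n k : ℕ} (p : Fin k → Pos n) (i : Fin n) : ℤ :=
  (Finset.card {m : Fin k | (p m).1.2 = i} : ℤ) - (Finset.card {m : Fin k | (p m).1.1 = i} : ℤ)

/-- The span in `⋀^k nil_n` of the wedges `e_{a₁b₁} ∧ ⋯ ∧ e_{aₖbₖ}` of weight `l`. (Wedges with a
repeated factor vanish, so these are the basis elements of weight `l`, up to sign.) -/
noncomputable def weightSpan (n : ℕ) (l : Fin n → ℤ) (k : ℕ) :
    Submodule ℤ (ExteriorAlgebra ℤ (nil n)) :=
  Submodule.span ℤ
    {a | ∃ p : Fin k → Pos n, weight p = l ∧ a = ExteriorAlgebra.ιMulti ℤ k (fun m => e (p m))}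

/-- The weight of a single matrix unit. -/
def root {n : ℕ} (s : Pos n) (i : Fin n) : ℤ :=
  (if s.1.2 = i then 1 else 0) - (if s.1.1 = i then 1 else 0)

theorem weight_succ {n k : ℕ} (p : Fin (k + 1) → Pos n) :
    weight p = root (p 0) + weight (fun m => p m.succ) := by
  ext i
  simp only [weight, root, Pi.add_apply, Finset.card_filter, Fin.sum_univ_succ]
  push_cast
  ring

theorem lie_e {n : ℕ} (s t : Pos n) :
    ⁅e s, e t⁆ = 0 ∨
      ∃ (c : ℤ) (r : Pos n), ⁅e s, e t⁆ = c • e r ∧ root r = root s + root t := by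
  obtain ⟨⟨a, b⟩, hab⟩ := s
  obtain ⟨⟨c, d⟩, hcd⟩ := t
  simp only at hab hcd
  by_cases hbc : b = c
  · subst hbc
    refine Or.inr ⟨1, ⟨(a, d), hab.trans hcd⟩, ?_, ?_⟩
    · apply Subtype.ext
      rw [one_smul]
      simp [e, Ring.lie_def, (hab.trans hcd).ne']
    · ext i; simp [root]
  · by_cases had : a = d
    · subst had
      refine Or.inr ⟨-1, ⟨(c, b), hcd.trans hab⟩, ?_, ?_⟩
      · apply Subtype.ext
        simp [e, Ring.lie_def, hbc]
      · ext i; simp [root]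
    · left
      apply Subtype.ext
      simp [e, Ring.lie_def, hbc, Ne.symm had]

theorem ι_mul_mem_weightSpan {n k : ℕ} {l : Fin n → ℤ} (s : Pos n)
    {a : ExteriorAlgebra ℤ (nil n)} (ha : a ∈ weightSpan n l k) :
    ExteriorAlgebra.ι ℤ (e s) * a ∈ weightSpan n (root s + l) (k + 1) := by
  induction ha using Submodule.span_induction with
  | zero => simp
  | add a b _ _ ha hb => rw [mul_add]; exact add_mem ha hb
  | smul c a _ ha => rw [mul_smul_comm]; exact Submodule.smul_mem _ c ha
  | mem a ha =>
    obtain ⟨p, rfl, rfl⟩ := ha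
    refine Submodule.subset_span ⟨Fin.cons s p, ?_, ?_⟩
    · rw [weight_succ]; simp
    · rw [ιMulti_succ']; simp

theorem adAction_mem_weightSpan {n k : ℕ} {l : Fin n → ℤ} (s : Pos n)
    {a : ExteriorAlgebra ℤ (nil n)} (ha : a ∈ weightSpan n l k) :
    adAction ℤ (e s) a ∈ weightSpan n (root s + l) k := by
  induction ha using Submodule.span_induction with
  | zero => simp
  | add a b _ _ ha hb => rw [map_add]; exact add_mem ha hb
  | smul c a _ ha => rw [map_smul]; exact Submodule.smul_mem _ c ha
  | mem a ha =>
    obtain ⟨p, rfl, rfl⟩ := ha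
    induction k with
    | zero => simp [adAction_one]
    | succ k ih =>
      rw [ιMulti_succ', adAction_ι_mul]
      refine add_mem ?_ ?_
      · rcases lie_e s (p 0) with h | ⟨c, r, h, hr⟩
        · simp [h]
        · rw [h, map_smul, smul_mul_assoc, weight_succ, ← add_assoc, ← hr]
          exact Submodule.smul_mem _ c
            (ι_mul_mem_weightSpan r (Submodule.subset_span ⟨_, rfl, rfl⟩))
      · rw [weight_succ, add_left_comm]
        exact ι_mul_mem_weightSpan _ (ih _)

theorem boundary_mem_weightSpan {n : ℕ} (l : Fin n → ℤ) (k : ℕ)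
    (a : ExteriorAlgebra ℤ (nil n)) (ha : a ∈ weightSpan n l (k + 1)) :
    boundary ℤ (nil n) a ∈ weightSpan n l k := by
  induction ha using Submodule.span_induction with
  | zero => simp
  | add a b _ _ ha hb => rw [map_add]; exact add_mem ha hb
  | smul c a _ ha => rw [map_smul]; exact Submodule.smul_mem _ c ha
  | mem a ha =>
    obtain ⟨p, rfl, rfl⟩ := ha
    induction k with
    | zero =>
      rw [ιMulti_succ', boundary_ι_mul, ExteriorAlgebra.ιMulti_zero_apply, adAction_one,
        boundary_one, mul_zero, add_zero, neg_zero]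
      exact zero_mem _
    | succ k ih =>
      rw [ιMulti_succ', boundary_ι_mul, weight_succ]
      exact neg_mem (add_mem
        (adAction_mem_weightSpan _ (Submodule.subset_span ⟨_, rfl, rfl⟩))
        (ι_mul_mem_weightSpan _ (ih _)))

theorem weightSpan_le {n : ℕ} (l : Fin n → ℤ) (k : ℕ) :
    weightSpan n l k ≤ ⋀[ℤ]^k (nil n) := by
  refine Submodule.span_le.2 ?_
  rintro _ ⟨p, _, rfl⟩
  exact ExteriorAlgebra.ιMulti_range ℤ k ⟨_, rfl⟩

/-- The weight vector `(1, …, n) - w`, where `w` is a modified weight vector. -/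
def unmodify {n : ℕ} (w : Fin n → ℤ) (i : Fin n) : ℤ := ((i : ℤ) + 1) - w i

/-- The subcomplex `⟦w₁, …, wₙ⟧` of the Chevalley–Eilenberg complex of `nil_n`, spanned by the
wedges of modified weight `(1, …, n) - weight` equal to `w`. -/
noncomputable def bracket {n : ℕ} (w : Fin n → ℤ) : ChainComplex (ModuleCat.{0} ℤ) ℕ :=
  complexOf (weightSpan n (unmodify w)) (boundary_mem_weightSpan (unmodify w))

/-- The inclusion of `⟦w⟧` in the Chevalley–Eilenberg complex of `nil_n`. -/
noncomputable def bracketIncl {n : ℕ} (w : Fin n → ℤ) :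
    bracket w ⟶ chevalleyEilenberg ℤ (nil n) :=
  complexIncl (boundary_mem_weightSpan (unmodify w)) boundary_mem_exteriorPower
    (weightSpan_le (unmodify w))

/-- The vector `(2, 3, …, q+1, 2, q+1, q+3, …, n)`, for `q + 2 ≤ n`; the entry with index `i : Fin n`
is the one in position `i + 1`. -/
def torsionWeight (q n : ℕ) (i : Fin n) : ℤ :=
  if (i : ℕ) < q then (i : ℤ) + 2
  else if (i : ℕ) = q then 2
  else if (i : ℕ) = q + 1 then (q : ℤ) + 1
  else (i : ℤ) + 1

end Nil

end LieHomology

/-!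
Put `A = q` and `B = q + 1`, with vertices numbered from `0`. A wedge of matrix units is a set of
edges `a → b` with `a < b`, and its weight records in-degree minus out-degree at each vertex. The
weight of `⟦w⟧` is that of all edges into `A` together with `A → B`. At most `A` edges end in `A`,
so a set of edges of this weight either contains all of them, and is this one (the apex), or misses
exactly one, say `v → A`, and the remaining edges form an increasing path from `v` to `B` that
avoids `A`. Such a path is a nonempty set of vertices below `A`, that is, a face of a full simplex,
and each nonzero bracket of two edges deletes one vertex: the boundary is the simplicial one,
up to signs. Coning off with the least vertex `0` therefore retracts `⟦w⟧` to a complex `ℤ → ℤ` in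
degrees `q + 1` and `q`.
The boundary of the apex is the sum of the `q` one-vertex paths, all homologous to each other, so
the differential of this complex is multiplication by `q`.

The wedges of a given weight span a direct summand because the boundary preserves weights, and
`e_s ↦ e_s ⊗ [weight of e_s]` extends to a coaction that separates them.
-/

namespace LieHomology

section Exterior

variable {R M : Type*} [CommRing R] [AddCommGroup M] [Module R M]

theorem ι_mul_ι_mul_swap (x y : M) (a : ExteriorAlgebra R M) :
    ExteriorAlgebra.ι R x * (ExteriorAlgebra.ι R y * a)
      = -(ExteriorAlgebra.ι R y * (ExteriorAlgebra.ι R x * a)) := by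
  rw [eq_neg_iff_add_eq_zero, ← mul_assoc, ← mul_assoc, ← add_mul,
    ExteriorAlgebra.ι_add_mul_swap, zero_mul]

theorem ι_mul_ι_mul_self (x : M) (a : ExteriorAlgebra R M) :
    ExteriorAlgebra.ι R x * (ExteriorAlgebra.ι R x * a) = 0 := by
  rw [← mul_assoc, ExteriorAlgebra.ι_sq_zero, zero_mul]

/-- The wedge of the entries of a list, in the order of the list. -/
noncomputable def wedgeList (R : Type*) {M : Type*} [CommRing R] [AddCommGroup M] [Module R M]
    (l : List M) : ExteriorAlgebra R M :=
  (l.map (ExteriorAlgebra.ι R)).prod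

@[simp]
theorem wedgeList_nil : wedgeList R ([] : List M) = 1 := rfl

@[simp]
theorem wedgeList_cons (x : M) (l : List M) :
    wedgeList R (x :: l) = ExteriorAlgebra.ι R x * wedgeList R l := by
  simp [wedgeList]

theorem wedgeList_append (l l' : List M) :
    wedgeList R (l ++ l') = wedgeList R l * wedgeList R l' := by
  simp [wedgeList]

theorem ιMulti_eq_wedgeList {k : ℕ} (x : Fin k → M) :
    ExteriorAlgebra.ιMulti R k x = wedgeList R (List.ofFn x) := by
  simp [ExteriorAlgebra.ιMulti_apply, wedgeList, List.map_ofFn, Function.comp_def]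

theorem wedgeList_perm {l l' : List M} (h : l.Perm l') :
    wedgeList R l' = wedgeList R l ∨ wedgeList R l' = -wedgeList R l := by
  induction h with
  | nil => exact Or.inl rfl
  | cons x _ ih => rcases ih with ih | ih <;> simp [ih]
  | swap x y l => right; simp only [wedgeList_cons, ι_mul_ι_mul_swap x y]
  | trans _ _ ih ih' => rcases ih with ih | ih <;> rcases ih' with ih' | ih' <;> simp [ih, ih']

theorem wedgeList_mem_iff_of_perm {l l' : List M} (h : l.Perm l')
    (N : Submodule R (ExteriorAlgebra R M)) : wedgeList R l ∈ N ↔ wedgeList R l' ∈ N := by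
  rcases wedgeList_perm (R := R) h with h | h <;> simp [h]

theorem ι_mul_wedgeList_eq_zero {x : M} {l : List M} (hx : x ∈ l) :
    ExteriorAlgebra.ι R x * wedgeList R l = 0 := by
  induction l with
  | nil => simp at hx
  | cons y l ih =>
    rw [wedgeList_cons]
    rcases List.mem_cons.1 hx with rfl | hx
    · exact ι_mul_ι_mul_self x _
    · rw [ι_mul_ι_mul_swap, ih hx, mul_zero, neg_zero]

/-- Contraction with the linear form `d`: the antiderivation of the exterior algebra that
extends `d`. -/
noncomputable def contract (d : Module.Dual R M) :
    ExteriorAlgebra R M →ₗ[R] ExteriorAlgebra R M :=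
  CliffordAlgebra.contractLeft (Q := (0 : QuadraticForm R M)) d

theorem contract_one (d : Module.Dual R M) : contract d (1 : ExteriorAlgebra R M) = 0 :=
  CliffordAlgebra.contractLeft_one (Q := (0 : QuadraticForm R M)) d

theorem contract_ι_mul (d : Module.Dual R M) (x : M) (a : ExteriorAlgebra R M) :
    contract d (ExteriorAlgebra.ι R x * a) = d x • a - ExteriorAlgebra.ι R x * contract d a :=
  CliffordAlgebra.contractLeft_ι_mul (Q := (0 : QuadraticForm R M)) d x a

theorem contract_contract_swap (d d' : Module.Dual R M) (a : ExteriorAlgebra R M) :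
    contract d (contract d' a) = -contract d' (contract d a) :=
  CliffordAlgebra.contractLeft_comm (Q := (0 : QuadraticForm R M)) d d' a

theorem contract_wedgeList_mul_eq_zero {d : Module.Dual R M} {l : List M} (hl : ∀ x ∈ l, d x = 0)
    {a : ExteriorAlgebra R M} (ha : contract d a = 0) : contract d (wedgeList R l * a) = 0 := by
  induction l with
  | nil => simpa using ha
  | cons x l ih =>
    rw [List.forall_mem_cons] at hl
    rw [wedgeList_cons, mul_assoc, contract_ι_mul, hl.1, ih hl.2, zero_smul, mul_zero, sub_zero]

/-- The derivation of the exterior algebra that extends the endomorphism `x ↦ d x • y`. -/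
noncomputable def rankOneDerivation (d : Module.Dual R M) (y : M) :
    ExteriorAlgebra R M →ₗ[R] ExteriorAlgebra R M :=
  LinearMap.mulLeft R (ExteriorAlgebra.ι R y) ∘ₗ contract d

theorem rankOneDerivation_apply (d : Module.Dual R M) (y : M) (a : ExteriorAlgebra R M) :
    rankOneDerivation d y a = ExteriorAlgebra.ι R y * contract d a := rfl

theorem rankOneDerivation_ι_mul (d : Module.Dual R M) (x y : M) (a : ExteriorAlgebra R M) :
    rankOneDerivation d y (ExteriorAlgebra.ι R x * a)
      = d x • (ExteriorAlgebra.ι R y * a) + ExteriorAlgebra.ι R x * rankOneDerivation d y a := by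
  rw [rankOneDerivation_apply, contract_ι_mul, mul_sub, mul_smul_comm, ι_mul_ι_mul_swap y x,
    sub_neg_eq_add, rankOneDerivation_apply]

theorem rankOneDerivation_mul (d : Module.Dual R M) (y : M) (a b : ExteriorAlgebra R M) :
    rankOneDerivation d y (a * b) = rankOneDerivation d y a * b + a * rankOneDerivation d y b := by
  induction a using CliffordAlgebra.left_induction with
  | algebraMap r =>
    simp [rankOneDerivation_apply, contract, ← Algebra.smul_def]
  | add a a' ha ha' => simp only [add_mul, map_add, ha, ha']; abel
  | ι_mul a x ha =>
    change rankOneDerivation d y (ExteriorAlgebra.ι R x * a * b) =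
      rankOneDerivation d y (ExteriorAlgebra.ι R x * a) * b
        + ExteriorAlgebra.ι R x * a * rankOneDerivation d y b
    simp only [mul_assoc, rankOneDerivation_ι_mul, ha, mul_add, add_mul, add_assoc,
      smul_mul_assoc]

end Exterior

section Derivations

variable {R L : Type*} [CommRing R] [LieRing L] [LieAlgebra R L]

theorem adAction_ι (x y : L) :
    adAction R x (ExteriorAlgebra.ι R y) = ExteriorAlgebra.ι R ⁅x, y⁆ := by
  simpa [adAction_one] using adAction_ι_mul (R := R) x y 1

theorem boundary_ι (x : L) : boundary R L (ExteriorAlgebra.ι R x) = 0 := by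
  simpa [adAction_one, boundary_one] using boundary_ι_mul (R := R) x 1

theorem adAction_mul (x : L) (a b : ExteriorAlgebra R L) :
    adAction R x (a * b) = adAction R x a * b + a * adAction R x b := by
  induction a using wedge_induction with
  | h0 r => simp [adAction_algebraMap, ← Algebra.smul_def]
  | hadd a a' ha ha' => simp only [add_mul, map_add, ha, ha']; abel
  | hmul y a ha => simp only [mul_assoc, adAction_ι_mul, ha, mul_add, add_mul, add_assoc]

theorem adAction_wedgeList_eq_sum {σ : Type*} {S : Finset σ} {x : L} {d : σ → Module.Dual R L}
    {y : σ → L} {l : List L} (hl : ∀ z ∈ l, ⁅x, z⁆ = ∑ i ∈ S, d i z • y i) :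
    adAction R x (wedgeList R l) = ∑ i ∈ S, rankOneDerivation (d i) (y i) (wedgeList R l) := by
  induction l with
  | nil => simp [adAction_one, rankOneDerivation_apply, contract_one]
  | cons z l ih =>
    rw [List.forall_mem_cons] at hl
    simp only [wedgeList_cons, adAction_ι_mul, rankOneDerivation_ι_mul, ih hl.2, hl.1, map_sum,
      map_smul, Finset.sum_mul, Finset.mul_sum, smul_mul_assoc, Finset.sum_add_distrib]

theorem adAction_wedgeList_eq_zero {x : L} {l : List L} (hl : ∀ z ∈ l, ⁅x, z⁆ = 0) :
    adAction R x (wedgeList R l) = 0 := by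
  simpa using adAction_wedgeList_eq_sum (S := (∅ : Finset Empty)) (d := nofun) (y := nofun) (l := l)
    (by simpa using hl)

theorem boundary_wedgeList_eq_zero {l : List L} (hl : ∀ x ∈ l, ∀ y ∈ l, ⁅x, y⁆ = 0) :
    boundary R L (wedgeList R l) = 0 := by
  induction l with
  | nil => simp [boundary_one]
  | cons x l ih =>
    rw [wedgeList_cons, boundary_ι_mul,
      adAction_wedgeList_eq_zero fun z hz => hl x (by simp) z (by simp [hz]),
      ih fun y hy z hz => hl y (by simp [hy]) z (by simp [hz]), mul_zero, add_zero, neg_zero]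

theorem boundary_wedgeList_mul {l : List L} {c : ExteriorAlgebra R L}
    (hl : ∀ x ∈ l, adAction R x c = 0) (hc : boundary R L c = 0) :
    boundary R L (wedgeList R l * c) = boundary R L (wedgeList R l) * c := by
  induction l with
  | nil => simp [hc, boundary_one]
  | cons x l ih =>
    rw [List.forall_mem_cons] at hl
    simp only [wedgeList_cons, mul_assoc, boundary_ι_mul, adAction_mul, hl.1, mul_zero, add_zero,
      ih hl.2, neg_mul, add_mul]

end Derivations

section Paths

variable {V : Type*}

/-- The edges `(v₀, v₁), …, (vᵣ, B)` of the path through the vertices `v₀, …, vᵣ` of a list that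
ends in `B`. -/
def pathEdges (B : V) (L : List V) : List (V × V) := L.zip (L.tail ++ [B])

@[simp]
theorem pathEdges_nil (B : V) : pathEdges B [] = [] := rfl

@[simp]
theorem pathEdges_singleton (B v : V) : pathEdges B [v] = [(v, B)] := rfl

@[simp]
theorem pathEdges_cons_cons (B u v : V) (L : List V) :
    pathEdges B (u :: v :: L) = (u, v) :: pathEdges B (v :: L) := rfl

theorem fst_mem_of_mem_pathEdges {B : V} {L : List V} {p : V × V} (hp : p ∈ pathEdges B L) :
    p.1 ∈ L :=
  (List.of_mem_zip hp).1

theorem snd_mem_of_mem_pathEdges {B : V} {L : List V} {p : V × V} (hp : p ∈ pathEdges B L) :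
    p.2 ∈ L.tail ++ [B] :=
  (List.of_mem_zip hp).2

theorem length_pathEdges (B : V) (L : List V) : (pathEdges B L).length = L.length := by
  simp only [pathEdges, List.length_zip, List.length_append, List.length_tail, List.length_cons,
    List.length_nil]
  omega

theorem lt_of_mem_pathEdges [Preorder V] {B : V} {L : List V} (hL : (L ++ [B]).Pairwise (· < ·)) :
    ∀ p ∈ pathEdges B L, p.1 < p.2 := by
  induction L with
  | nil => simp
  | cons u L ih =>
    rw [List.cons_append, List.pairwise_cons] at hL
    cases L with
    | nil => simpa using hL.1
    | cons v L => simpa [hL.1 v (by simp)] using ih hL.2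

end Paths

section Edges

attribute [local instance] LieRing.ofAssociativeRing

variable {n : ℕ}

/-- The matrix unit `e_{ab}` for `a < b`, extended by the value `0` to all pairs `(a, b)`. -/
def edge (a b : Fin n) : nil n := if h : a < b then e ⟨(a, b), h⟩ else 0

theorem edge_of_lt {a b : Fin n} (h : a < b) : edge a b = e ⟨(a, b), h⟩ := dif_pos h

theorem e_eq_edge (s : Pos n) : e s = edge s.1.1 s.1.2 := (edge_of_lt s.2).symm

theorem coe_edge {a b : Fin n} (h : a < b) :
    (edge a b : Matrix (Fin n) (Fin n) ℤ) = Matrix.single a b 1 := by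
  rw [edge_of_lt h, e]

theorem lie_edge_edge {a b c d : Fin n} (hab : a < b) (hcd : c < d) :
    ⁅edge a b, edge c d⁆
      = (if b = c then edge a d else 0) - (if a = d then edge c b else 0) := by
  apply Subtype.ext
  rw [LieSubalgebra.coe_bracket, Ring.lie_def, coe_edge hab, coe_edge hcd]
  rcases eq_or_ne b c with rfl | hbc
  · have had := (hab.trans hcd).ne
    simp [coe_edge (hab.trans hcd), had, had.symm]
  · rcases eq_or_ne a d with rfl | had
    · simp [coe_edge (hcd.trans hab), hbc]
    · simp [hbc, had, had.symm]

/-- The matrix entry `x ↦ x_{ab}`, as a linear form on `nil_n`. -/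
def entry (a b : Fin n) : Module.Dual ℤ (nil n) :=
  Matrix.entryLinearMap ℤ ℤ a b ∘ₗ (nil n).toSubmodule.subtype

theorem entry_apply (a b : Fin n) (x : nil n) : entry a b x = x.1 a b := rfl

theorem entry_edge_of_ne {a b c d : Fin n} (h : ¬(c = a ∧ d = b)) : entry a b (edge c d) = 0 := by
  by_cases hcd : c < d
  · rw [entry_apply, coe_edge hcd, Matrix.single_apply, if_neg h]
  · rw [edge, dif_neg hcd, map_zero]

theorem entry_edge_self {a b : Fin n} (h : a < b) : entry a b (edge a b) = 1 := by
  rw [entry_apply, coe_edge h, Matrix.single_apply_same]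

/-- The wedge of the matrix units at the positions in a list. -/
noncomputable def wedgeEdges (l : List (Fin n × Fin n)) : ExteriorAlgebra ℤ (nil n) :=
  wedgeList ℤ (l.map fun p => edge p.1 p.2)

@[simp]
theorem wedgeEdges_nil : wedgeEdges ([] : List (Fin n × Fin n)) = 1 := rfl

@[simp]
theorem wedgeEdges_cons (p : Fin n × Fin n) (l : List (Fin n × Fin n)) :
    wedgeEdges (p :: l) = ExteriorAlgebra.ι ℤ (edge p.1 p.2) * wedgeEdges l :=
  wedgeList_cons _ _

theorem wedgeEdges_append (l l' : List (Fin n × Fin n)) :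
    wedgeEdges (l ++ l') = wedgeEdges l * wedgeEdges l' := by
  rw [wedgeEdges, List.map_append, wedgeList_append, wedgeEdges, wedgeEdges]

theorem wedgeEdges_mem_iff_of_perm {l l' : List (Fin n × Fin n)} (h : l.Perm l')
    (N : Submodule ℤ (ExteriorAlgebra ℤ (nil n))) : wedgeEdges l ∈ N ↔ wedgeEdges l' ∈ N :=
  wedgeList_mem_iff_of_perm (h.map _) N

theorem contract_wedgeEdges_mul_eq_zero {a b : Fin n} {l : List (Fin n × Fin n)}
    (hl : (a, b) ∉ l) {c : ExteriorAlgebra ℤ (nil n)} (hc : contract (entry a b) c = 0) :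
    contract (entry a b) (wedgeEdges l * c) = 0 := by
  refine contract_wedgeList_mul_eq_zero (List.forall_mem_map.2 fun p hp => ?_) hc
  refine entry_edge_of_ne ?_
  rintro ⟨rfl, rfl⟩
  exact hl hp

theorem contract_wedgeEdges_eq_zero {a b : Fin n} {l : List (Fin n × Fin n)} (hl : (a, b) ∉ l) :
    contract (entry a b) (wedgeEdges l) = 0 := by
  simpa using contract_wedgeEdges_mul_eq_zero hl (contract_one _)

theorem adAction_wedgeEdges_pathEdges {u v B : Fin n} {L : List (Fin n)}
    (h : (u :: v :: L ++ [B]).Pairwise (· < ·)) :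
    adAction ℤ (edge u v) (wedgeEdges (pathEdges B (v :: L)))
      = wedgeEdges (pathEdges B (u :: L)) := by
  simp only [List.cons_append, List.pairwise_cons] at h
  obtain ⟨hu, hv, hL⟩ := h
  have huv : u < v := hu v (by simp)
  cases L with
  | nil =>
    have hvB : v < B := hv B (by simp)
    simp [adAction_ι, lie_edge_edge huv hvB, (huv.trans hvB).ne]
  | cons w L =>
    have hvw : v < w := hv w (by simp)
    have hrest : adAction ℤ (edge u v) (wedgeEdges (pathEdges B (w :: L))) = 0 := by
      refine adAction_wedgeList_eq_zero (List.forall_mem_map.2 fun p hp => ?_)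
      have hvp := hv p.1 (List.mem_append_left _ (fst_mem_of_mem_pathEdges hp))
      have hp' := lt_of_mem_pathEdges hL p hp
      simp [lie_edge_edge huv hp', hvp.ne, (huv.trans (hvp.trans hp')).ne]
    simp [adAction_ι_mul, hrest, lie_edge_edge huv hvw, (huv.trans hvw).ne]

end Edges
section Stars

attribute [local instance] LieRing.ofAssociativeRing

/-- The edges into `A` from the vertices of a list. -/
def inEdges {V : Type*} (A : V) (S : List V) : List (V × V) := S.map fun v => (v, A)

variable {n : ℕ} {A B : Fin n}

/-- The vertices below `A`, in increasing order. -/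
def below (A : Fin n) : List (Fin n) := List.ofFn (Fin.castLE (m := n) A.2.le)

theorem mem_below {v : Fin n} : v ∈ below A ↔ v < A := by
  rw [below, List.mem_ofFn]
  exact ⟨by rintro ⟨i, rfl⟩; exact i.2, fun h => ⟨⟨v, h⟩, rfl⟩⟩

theorem nodup_below (A : Fin n) : (below A).Nodup :=
  List.nodup_ofFn.2 (Fin.castLE_injective _)

theorem length_below (A : Fin n) : (below A).length = A := List.length_ofFn

theorem adAction_wedgeEdges_inEdges {u v : Fin n} {S : List (Fin n)} (hS : ∀ x ∈ S, x < A)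
    (huv : u < v) (huA : u ≠ A) :
    adAction ℤ (edge u v) (wedgeEdges (inEdges A S))
      = rankOneDerivation (entry v A) (edge u A) (wedgeEdges (inEdges A S)) := by
  refine (adAction_wedgeList_eq_sum (S := {()}) (d := fun _ => entry v A) (y := fun _ => edge u A)
    ?_).trans (Finset.sum_singleton _ _)
  simp only [inEdges, List.map_map, List.forall_mem_map, Function.comp_apply, Finset.sum_singleton]
  intro x hx
  rw [lie_edge_edge huv (hS x hx), if_neg huA, sub_zero]
  split_ifs with hvx
  · rw [hvx, entry_edge_self (hS x hx), one_smul]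
  · rw [entry_edge_of_ne (by tauto), zero_smul]

theorem adAction_edge_wedgeEdges_inEdges {S : List (Fin n)} (hS : ∀ x ∈ S, x < A) (hAB : A < B) :
    adAction ℤ (edge A B) (wedgeEdges (inEdges A S))
      = -∑ v ∈ Finset.Iio A,
          rankOneDerivation (entry v A) (edge v B) (wedgeEdges (inEdges A S)) := by
  rw [← Finset.sum_neg_distrib]
  refine (adAction_wedgeList_eq_sum (S := Finset.Iio A) (d := fun v => entry v A)
    (y := fun v => -edge v B) ?_).trans
      (Finset.sum_congr rfl fun v _ => by simp [rankOneDerivation_apply, wedgeEdges])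
  simp only [inEdges, List.map_map, List.forall_mem_map, Function.comp_apply]
  intro x hx
  rw [lie_edge_edge hAB (hS x hx), if_neg ((hS x hx).trans hAB).ne', if_pos rfl, zero_sub,
    Finset.sum_eq_single_of_mem x (Finset.mem_Iio.2 (hS x hx)), entry_edge_self (hS x hx), one_smul]
  intro v _ hvx
  rw [entry_edge_of_ne (by simp [hvx.symm]), zero_smul]

theorem boundary_wedgeEdges_inEdges {S : List (Fin n)} (hS : ∀ x ∈ S, x < A) :
    boundary ℤ (nil n) (wedgeEdges (inEdges A S)) = 0 := by
  refine boundary_wedgeList_eq_zero ?_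
  simp only [inEdges, List.map_map, List.forall_mem_map, Function.comp_apply]
  intro x hx y hy
  rw [lie_edge_edge (hS x hx) (hS y hy), if_neg (hS y hy).ne', if_neg (hS x hx).ne, sub_zero]

/-- The wedge of all matrix units `e_{vA}`, for `v < A`. -/
noncomputable def inStar (A : Fin n) : ExteriorAlgebra ℤ (nil n) :=
  wedgeEdges (inEdges A (below A))

/-- The wedge of the matrix units `e_{vA}` for `v < A` and `v ≠ i`, with the sign that makes
`e_{iA} ∧ inStarFace A i = inStar A`. -/
noncomputable def inStarFace (A i : Fin n) : ExteriorAlgebra ℤ (nil n) :=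
  contract (entry i A) (inStar A)

theorem inStarFace_eq_wedgeEdges_or_neg {i : Fin n} (hi : i < A) :
    inStarFace A i = wedgeEdges (inEdges A ((below A).erase i))
      ∨ inStarFace A i = -wedgeEdges (inEdges A ((below A).erase i)) := by
  have hperm : (inEdges A (i :: (below A).erase i)).Perm (inEdges A (below A)) :=
    (List.perm_cons_erase (mem_below.2 hi)).symm.map _
  have hcontract : contract (entry i A) (wedgeEdges (inEdges A (i :: (below A).erase i)))
      = wedgeEdges (inEdges A ((below A).erase i)) := by
    have hnotMem : (i, A) ∉ inEdges A ((below A).erase i) := by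
      simp [inEdges, (nodup_below A).mem_erase_iff]
    rw [inEdges, List.map_cons, wedgeEdges_cons, contract_ι_mul, entry_edge_self hi, one_smul,
      ← inEdges, contract_wedgeEdges_eq_zero hnotMem, mul_zero, sub_zero]
  rw [← hcontract, ← map_neg]
  exact (wedgeList_perm (hperm.map _)).imp (congrArg (contract _)) (congrArg (contract _))

theorem ι_edge_mul_inStarFace {j : Fin n} (hj : j < A) (i : Fin n) :
    ExteriorAlgebra.ι ℤ (edge j A) * inStarFace A i = if j = i then inStar A else 0 := by
  have hzero : ExteriorAlgebra.ι ℤ (edge j A) * inStar A = 0 :=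
    ι_mul_wedgeList_eq_zero (List.mem_map.2 ⟨(j, A), List.mem_map.2 ⟨j, mem_below.2 hj, rfl⟩, rfl⟩)
  have hcontract := contract_ι_mul (entry i A) (edge j A) (inStar A)
  rw [hzero, map_zero, eq_comm, sub_eq_zero] at hcontract
  rw [inStarFace, ← hcontract]
  split_ifs with hji
  · rw [← hji, entry_edge_self hj, one_smul]
  · rw [entry_edge_of_ne (by tauto), zero_smul]

theorem ι_edge_mul_contract_inStarFace {u v : Fin n} (hu : u < A) (huv : u ≠ v) (i : Fin n) :
    ExteriorAlgebra.ι ℤ (edge u A) * contract (entry v A) (inStarFace A i)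
      = if u = i then -inStarFace A v else 0 := by
  have hzero : ExteriorAlgebra.ι ℤ (edge u A) * inStarFace A v = 0 := by
    rw [ι_edge_mul_inStarFace hu, if_neg huv]
  have hcontract := contract_ι_mul (entry i A) (edge u A) (inStarFace A v)
  rw [hzero, map_zero, eq_comm, sub_eq_zero] at hcontract
  rw [inStarFace, contract_contract_swap, ← inStarFace, mul_neg, ← hcontract]
  split_ifs with hui
  · rw [← hui, entry_edge_self hu, one_smul]
  · rw [entry_edge_of_ne (by tauto), zero_smul, neg_zero]

theorem adAction_inStarFace {u v i : Fin n} (hu : u < A) (huv : u < v) (hi : i < A) :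
    adAction ℤ (edge u v) (inStarFace A i) = if u = i then -inStarFace A v else 0 := by
  have hderiv : adAction ℤ (edge u v) (inStarFace A i)
      = rankOneDerivation (entry v A) (edge u A) (inStarFace A i) := by
    have hwedge := adAction_wedgeEdges_inEdges
      (fun x hx => mem_below.1 (List.mem_of_mem_erase hx)) huv hu.ne (S := (below A).erase i)
    rcases inStarFace_eq_wedgeEdges_or_neg hi with h | h <;> simp only [h, map_neg, hwedge]
  rw [hderiv, rankOneDerivation_apply, ι_edge_mul_contract_inStarFace hu huv.ne]

theorem boundary_inStarFace {i : Fin n} (hi : i < A) : boundary ℤ (nil n) (inStarFace A i) = 0 := by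
  have hwedge := boundary_wedgeEdges_inEdges
    (fun x hx => mem_below.1 (List.mem_of_mem_erase hx)) (S := (below A).erase i)
  rcases inStarFace_eq_wedgeEdges_or_neg hi with h | h <;> simp [h, hwedge]

end Stars

section Generators

attribute [local instance] LieRing.ofAssociativeRing

theorem pairwise_lt_append_of_lt {V : Type*} [Preorder V] {A B : V} {L : List V} (hAB : A < B)
    (hL : (L ++ [A]).Pairwise (· < ·)) : (L ++ [B]).Pairwise (· < ·) := by
  simp only [List.pairwise_append, List.mem_singleton, forall_eq] at hL ⊢
  exact ⟨hL.1, List.pairwise_singleton _ _, fun v hv => (hL.2.2 v hv).trans hAB⟩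

theorem lt_of_mem_of_pairwise_append {V : Type*} [Preorder V] {A v : V} {L : List V}
    (hL : (L ++ [A]).Pairwise (· < ·)) (hv : v ∈ L) : v < A :=
  (List.pairwise_append.1 hL).2.2 v hv A (List.mem_singleton_self A)

variable {n : ℕ} {A B : Fin n}

theorem boundary_wedgeEdges_pathEdges {u v : Fin n} {L : List (Fin n)}
    (hL : (u :: v :: L ++ [B]).Pairwise (· < ·)) :
    boundary ℤ (nil n) (wedgeEdges (pathEdges B (u :: v :: L)))
      = -(wedgeEdges (pathEdges B (u :: L))
          + ExteriorAlgebra.ι ℤ (edge u v)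
            * boundary ℤ (nil n) (wedgeEdges (pathEdges B (v :: L)))) := by
  rw [pathEdges_cons_cons, wedgeEdges_cons, boundary_ι_mul, adAction_wedgeEdges_pathEdges hL]

theorem contract_wedgeEdges_pathEdges {L : List (Fin n)} (hAB : A < B)
    (hL : (L ++ [A]).Pairwise (· < ·)) (i : Fin n) :
    contract (entry i A) (wedgeEdges (pathEdges B L)) = 0 := by
  refine contract_wedgeEdges_eq_zero fun hmem => ?_
  rcases List.mem_append.1 (snd_mem_of_mem_pathEdges hmem) with h | h
  · exact (lt_of_mem_of_pairwise_append hL (List.mem_of_mem_tail h)).false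
  · exact hAB.ne (List.mem_singleton.1 h)

theorem contract_boundary_wedgeEdges_pathEdges {L : List (Fin n)} (hAB : A < B)
    (hL : (L ++ [A]).Pairwise (· < ·)) (i : Fin n) :
    contract (entry i A) (boundary ℤ (nil n) (wedgeEdges (pathEdges B L))) = 0 := by
  induction L with
  | nil => simp [boundary_one]
  | cons u L ih =>
    cases L with
    | nil => simp [boundary_ι]
    | cons v L =>
      have hvL : (v :: L ++ [A]).Pairwise (· < ·) := hL.of_cons
      have huL : (u :: L ++ [A]).Pairwise (· < ·) :=
        hL.sublist ((List.sublist_cons_self v _).cons_cons u)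
      have hvA : v < A := lt_of_mem_of_pairwise_append hL (by simp)
      rw [boundary_wedgeEdges_pathEdges (pairwise_lt_append_of_lt hAB hL), map_neg, map_add,
        contract_wedgeEdges_pathEdges hAB huL, contract_ι_mul, ih hvL,
        entry_edge_of_ne (by simp [hvA.ne]), zero_smul, mul_zero, sub_zero, add_zero, neg_zero]

theorem boundary_wedgeEdges_pathEdges_mul_inStarFace {u : Fin n} {L : List (Fin n)} (hAB : A < B)
    (hL : (L ++ [A]).Pairwise (· < ·)) (hu : u < A) (huL : u ∉ L) :
    boundary ℤ (nil n) (wedgeEdges (pathEdges B L) * inStarFace A u)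
      = boundary ℤ (nil n) (wedgeEdges (pathEdges B L)) * inStarFace A u := by
  refine boundary_wedgeList_mul (List.forall_mem_map.2 fun p hp => ?_) (boundary_inStarFace hu)
  have hp₁ : p.1 ∈ L := fst_mem_of_mem_pathEdges hp
  rw [adAction_inStarFace (lt_of_mem_of_pairwise_append hL hp₁)
    (lt_of_mem_pathEdges (pairwise_lt_append_of_lt hAB hL) p hp) hu,
    if_neg (ne_of_mem_of_not_mem hp₁ huL)]

/-- The wedge of the edges of the path through `v` and the vertices of `L` to `B`, and of all edges
into `A` except the one from `v`. -/
noncomputable def pathGen (A B v : Fin n) (L : List (Fin n)) : ExteriorAlgebra ℤ (nil n) :=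
  wedgeEdges (pathEdges B (v :: L)) * inStarFace A v

theorem boundary_pathGen_cons {u v : Fin n} {L : List (Fin n)} (hAB : A < B)
    (hL : (u :: v :: L ++ [A]).Pairwise (· < ·)) :
    boundary ℤ (nil n) (pathGen A B u (v :: L))
      = boundary ℤ (nil n) (wedgeEdges (pathEdges B (u :: v :: L))) * inStarFace A u
        + pathGen A B v L := by
  have hu : u < A := lt_of_mem_of_pairwise_append hL (by simp)
  have huv : u < v := List.rel_of_pairwise_cons hL (by simp)
  have huL : u ∉ v :: L := fun h =>
    (List.rel_of_pairwise_cons hL (List.mem_append_left _ h)).false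
  have hpath := pairwise_lt_append_of_lt hAB hL
  rw [pathGen, pathEdges_cons_cons, wedgeEdges_cons, mul_assoc, boundary_ι_mul, boundary_ι_mul,
    adAction_mul, adAction_wedgeEdges_pathEdges hpath, adAction_inStarFace hu huv hu, if_pos rfl,
    boundary_wedgeEdges_pathEdges_mul_inStarFace hAB hL.of_cons hu huL, pathGen]
  noncomm_ring

theorem boundary_pathGen_nil {v : Fin n} (hv : v < A) (hAB : A < B) :
    boundary ℤ (nil n) (pathGen A B v []) = 0 := by
  have hface : inStarFace A B = 0 :=
    contract_wedgeEdges_eq_zero (by simp [inEdges, mem_below, hAB.le])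
  rw [pathGen, pathEdges_singleton, wedgeEdges_cons, wedgeEdges_nil, mul_one, boundary_ι_mul,
    adAction_inStarFace hv (hv.trans hAB) hv, if_pos rfl, hface, boundary_inStarFace hv, mul_zero,
    neg_zero, add_zero, neg_zero]

theorem boundary_pathGen_singleton {u v : Fin n} (huv : u < v) (hv : v < A) (hAB : A < B) :
    boundary ℤ (nil n) (pathGen A B u [v]) = pathGen A B v [] - pathGen A B u [] := by
  have hvB := hv.trans hAB
  rw [boundary_pathGen_cons hAB (by simp [huv, hv, huv.trans hv]),
    boundary_wedgeEdges_pathEdges (by simp [huv, hvB, huv.trans hvB]), pathGen, pathGen]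
  simp only [pathEdges_singleton, wedgeEdges_cons, wedgeEdges_nil, mul_one, boundary_ι, mul_zero,
    add_zero]
  noncomm_ring

/-- The wedge of the edge from `A` to `B` and of all edges into `A`. -/
noncomputable def apexGen (A B : Fin n) : ExteriorAlgebra ℤ (nil n) :=
  ExteriorAlgebra.ι ℤ (edge A B) * inStar A

theorem boundary_apexGen (hAB : A < B) :
    boundary ℤ (nil n) (apexGen A B) = ∑ v ∈ Finset.Iio A, pathGen A B v [] := by
  have hbelow : ∀ x ∈ below A, x < A := fun x => mem_below.1
  rw [apexGen, boundary_ι_mul, inStar, boundary_wedgeEdges_inEdges hbelow, mul_zero, add_zero,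
    adAction_edge_wedgeEdges_inEdges hbelow hAB, neg_neg]
  simp [pathGen, rankOneDerivation_apply, inStarFace, inStar]

end Generators

section Cone

attribute [local instance] LieRing.ofAssociativeRing

variable {n : ℕ} {A B : Fin n}

/-- The contracting homotopy that cones off with the vertex `o`: it prepends `o` to the path of a
generator that does not start with `o`; see `prepend_pathGen`. -/
noncomputable def prepend (A o : Fin n) :
    ExteriorAlgebra ℤ (nil n) →ₗ[ℤ] ExteriorAlgebra ℤ (nil n) :=
  -∑ v ∈ Finset.Ioo o A, LinearMap.mulLeft ℤ (ExteriorAlgebra.ι ℤ (edge o v))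
    ∘ₗ rankOneDerivation (entry o A) (edge v A)

theorem prepend_mul_inStarFace {o i : Fin n} (hi : i < A) {p : ExteriorAlgebra ℤ (nil n)}
    (hp : contract (entry o A) p = 0) :
    prepend A o (p * inStarFace A i)
      = if o < i then ExteriorAlgebra.ι ℤ (edge o i) * (p * inStarFace A o) else 0 := by
  have hterm : ∀ v ∈ Finset.Ioo o A, ExteriorAlgebra.ι ℤ (edge o v)
      * rankOneDerivation (entry o A) (edge v A) (p * inStarFace A i)
        = if v = i then -(ExteriorAlgebra.ι ℤ (edge o i) * (p * inStarFace A o)) else 0 := by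
    intro v hv
    rw [Finset.mem_Ioo] at hv
    rw [rankOneDerivation_mul, rankOneDerivation_apply, hp, mul_zero, zero_mul, zero_add,
      rankOneDerivation_apply, ι_edge_mul_contract_inStarFace hv.2 hv.1.ne']
    split_ifs with h
    · rw [h, mul_neg, mul_neg]
    · rw [mul_zero, mul_zero]
  simp only [prepend, LinearMap.neg_apply, LinearMap.sum_apply, LinearMap.comp_apply,
    LinearMap.mulLeft_apply]
  rw [Finset.sum_congr rfl hterm, Finset.sum_ite_eq']
  simp only [Finset.mem_Ioo, hi, and_true]
  split_ifs
  · rw [neg_neg]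
  · rw [neg_zero]

theorem prepend_apexGen (o : Fin n) (hAB : A < B) : prepend A o (apexGen A B) = 0 := by
  simp only [prepend, LinearMap.neg_apply, LinearMap.sum_apply, LinearMap.comp_apply,
    LinearMap.mulLeft_apply]
  refine neg_eq_zero.2 (Finset.sum_eq_zero fun v hv => ?_)
  rw [Finset.mem_Ioo] at hv
  rw [apexGen, rankOneDerivation_ι_mul, entry_edge_of_ne (by simp [hAB.ne']), zero_smul, zero_add,
    rankOneDerivation_apply, ← inStarFace, ι_edge_mul_inStarFace hv.2, if_neg hv.1.ne', mul_zero,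
    mul_zero]

theorem prepend_pathGen {o v : Fin n} {L : List (Fin n)} (hov : o < v) (hAB : A < B)
    (hL : (v :: L ++ [A]).Pairwise (· < ·)) :
    prepend A o (pathGen A B v L) = pathGen A B o (v :: L) := by
  rw [pathGen, prepend_mul_inStarFace (lt_of_mem_of_pairwise_append hL (by simp))
    (contract_wedgeEdges_pathEdges hAB hL o), if_pos hov, ← mul_assoc, ← wedgeEdges_cons (o, v),
    ← pathEdges_cons_cons, pathGen]

theorem prepend_pathGen_self {o : Fin n} {L : List (Fin n)} (hAB : A < B)
    (hL : (o :: L ++ [A]).Pairwise (· < ·)) :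
    prepend A o (pathGen A B o L) = 0 := by
  rw [pathGen, prepend_mul_inStarFace (lt_of_mem_of_pairwise_append hL (by simp))
    (contract_wedgeEdges_pathEdges hAB hL o), if_neg (lt_irrefl o)]

theorem boundary_prepend_add_prepend_boundary_pathGen {o u v : Fin n} {L : List (Fin n)}
    (ho : IsBot o) (hAB : A < B) (hL : (u :: v :: L ++ [A]).Pairwise (· < ·)) :
    boundary ℤ (nil n) (prepend A o (pathGen A B u (v :: L)))
        + prepend A o (boundary ℤ (nil n) (pathGen A B u (v :: L)))
      = pathGen A B u (v :: L) := by
  have hu : u < A := lt_of_mem_of_pairwise_append hL (by simp)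
  have huv : u < v := List.rel_of_pairwise_cons hL (by simp)
  have hvL : (v :: L ++ [A]).Pairwise (· < ·) := hL.of_cons
  rw [boundary_pathGen_cons hAB hL, map_add (prepend A o), prepend_mul_inStarFace hu
    (contract_boundary_wedgeEdges_pathEdges hAB hL o),
    prepend_pathGen ((ho u).trans_lt huv) hAB hvL]
  rcases (ho u).eq_or_lt with rfl | hou
  · rw [prepend_pathGen_self hAB hL, map_zero, if_neg (lt_irrefl o), zero_add, zero_add]
  · have hoL : (o :: u :: v :: L ++ [A]).Pairwise (· < ·) :=
      List.pairwise_cons_cons_iff_of_trans.2 ⟨hou, hL⟩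
    rw [prepend_pathGen hou hAB hL, boundary_pathGen_cons hAB hoL, if_pos hou,
      boundary_wedgeEdges_pathEdges (pairwise_lt_append_of_lt hAB hoL), pathGen, pathGen]
    simp only [pathEdges_cons_cons, wedgeEdges_cons]
    noncomm_ring

end Cone

section Augmentation

attribute [local instance] LieRing.ofAssociativeRing

variable {n : ℕ} {A B : Fin n}

/-- The linear map to `ℤ^A` that reads off columns `A` and `B` of a matrix and adds them. -/
def addColumns (A B : Fin n) : nil n →ₗ[ℤ] Fin A → ℤ :=
  LinearMap.pi fun i => entry (Fin.castLE A.2.le i) A + entry (Fin.castLE A.2.le i) B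

theorem addColumns_edge_of_ne {a b : Fin n} (hA : b ≠ A) (hB : b ≠ B) :
    addColumns A B (edge a b) = 0 := by
  ext i
  simp [addColumns, entry_edge_of_ne, hA, hB]

theorem addColumns_edge (hAB : A < B) (i : Fin A) {C : Fin n} (hC : C = A ∨ C = B) :
    addColumns A B (edge (Fin.castLE A.2.le i) C) = Pi.single i 1 := by
  have hiA : Fin.castLE A.2.le i < A := i.2
  ext j
  simp only [addColumns, LinearMap.pi_apply, LinearMap.add_apply]
  rcases eq_or_ne j i with rfl | hji
  · rcases hC with rfl | rfl
    · rw [entry_edge_self hiA, entry_edge_of_ne (by simp [hAB.ne]), Pi.single_eq_same, add_zero]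
    · rw [entry_edge_self (hiA.trans hAB), entry_edge_of_ne (by simp [hAB.ne']),
        Pi.single_eq_same, zero_add]
  · rw [entry_edge_of_ne (by simp [hji.symm]), entry_edge_of_ne (by simp [hji.symm]),
      Pi.single_eq_of_ne hji, add_zero]

theorem addColumns_edge_apex : addColumns A B (edge A B) = 0 := by
  ext j
  have hj : A ≠ Fin.castLE A.2.le j := (show Fin.castLE A.2.le j < A from j.2).ne'
  simp [addColumns, entry_edge_of_ne, hj]

/-- The augmentation, with value `1` on each generator `pathGen A B v []`: the determinant of the
image of an exterior power of degree `A` under `addColumns A B`. -/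
noncomputable def augmentation (A B : Fin n) : ExteriorAlgebra ℤ (nil n) →ₗ[ℤ] ℤ :=
  ExteriorAlgebra.liftAlternating (Pi.single (A : ℕ) (Matrix.detRowAlternating (R := ℤ)))
    ∘ₗ (ExteriorAlgebra.map (addColumns A B)).toLinearMap

theorem augmentation_ι_mul_eq_zero {x : nil n} (hx : addColumns A B x = 0)
    (a : ExteriorAlgebra ℤ (nil n)) : augmentation A B (ExteriorAlgebra.ι ℤ x * a) = 0 := by
  simp [augmentation, hx]

theorem augmentation_inStar (hAB : A < B) : augmentation A B (inStar A) = 1 := by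
  have hmap : ExteriorAlgebra.map (addColumns A B) (inStar A)
      = ExteriorAlgebra.ιMulti ℤ A fun i => (Pi.single i 1 : Fin A → ℤ) := by
    rw [inStar, wedgeEdges, inEdges, below, List.map_map, List.map_ofFn, ← ιMulti_eq_wedgeList,
      ExteriorAlgebra.map_apply_ιMulti]
    exact congrArg _ (funext fun i => addColumns_edge hAB i (Or.inl rfl))
  rw [augmentation, LinearMap.comp_apply, AlgHom.toLinearMap_apply, hmap,
    ExteriorAlgebra.liftAlternating_apply_ιMulti, Pi.single_eq_same]
  refine (congrArg Matrix.det (Matrix.ext fun i j => ?_)).trans Matrix.det_one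
  rw [Matrix.one_apply, Pi.single_apply]
  simp only [eq_comm]

theorem augmentation_pathGen_nil {v : Fin n} (hv : v < A) (hAB : A < B) :
    augmentation A B (pathGen A B v []) = 1 := by
  obtain ⟨i, rfl⟩ : ∃ i : Fin A, Fin.castLE A.2.le i = v := ⟨⟨v, hv⟩, rfl⟩
  have hstar := (ι_edge_mul_inStarFace hv _).trans (if_pos rfl)
  rw [← augmentation_inStar hAB, ← hstar]
  simp [pathGen, augmentation, addColumns_edge hAB]

theorem augmentation_pathGen_cons {u v : Fin n} {L : List (Fin n)} (hAB : A < B) (hv : v < A) :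
    augmentation A B (pathGen A B u (v :: L)) = 0 := by
  rw [pathGen, pathEdges_cons_cons, wedgeEdges_cons, mul_assoc]
  exact augmentation_ι_mul_eq_zero (addColumns_edge_of_ne hv.ne (hv.trans hAB).ne) _

theorem augmentation_apexGen : augmentation A B (apexGen A B) = 0 :=
  augmentation_ι_mul_eq_zero addColumns_edge_apex _

/-- The linear form with value `1` on the generator `apexGen A B` and `0` on the other ones. -/
noncomputable def apexCoeff (A B : Fin n) : ExteriorAlgebra ℤ (nil n) →ₗ[ℤ] ℤ :=
  augmentation A B ∘ₗ contract (entry A B)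

theorem contract_inStar (hAB : A < B) : contract (entry A B) (inStar A) = 0 :=
  contract_wedgeEdges_eq_zero (by simp [inEdges, hAB.ne])

theorem apexCoeff_apexGen (hAB : A < B) : apexCoeff A B (apexGen A B) = 1 := by
  rw [apexCoeff, LinearMap.comp_apply, apexGen, contract_ι_mul, contract_inStar hAB,
    entry_edge_self hAB, one_smul, mul_zero, sub_zero, augmentation_inStar hAB]

theorem apexCoeff_pathGen {v : Fin n} {L : List (Fin n)} (hAB : A < B)
    (hL : (v :: L ++ [A]).Pairwise (· < ·)) : apexCoeff A B (pathGen A B v L) = 0 := by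
  have hpath : (A, B) ∉ pathEdges B (v :: L) := fun h =>
    (lt_of_mem_of_pairwise_append hL (fst_mem_of_mem_pathEdges h)).false
  have hface : contract (entry A B) (inStarFace A v) = 0 := by
    rw [inStarFace, contract_contract_swap, contract_inStar hAB, map_zero, neg_zero]
  rw [apexCoeff, LinearMap.comp_apply, pathGen, contract_wedgeEdges_mul_eq_zero hpath hface,
    map_zero]

end Augmentation

section EdgeWeights

variable {V : Type*} [LinearOrder V]

/-- The weight `ε_b - ε_a` of the edge `(a, b)`; see `root_eq_edgeWeight`. -/
def edgeWeight (p : V × V) : V → ℤ := Pi.single p.2 1 - Pi.single p.1 1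

theorem edgeWeight_add_edgeWeight (a b c : V) :
    edgeWeight (a, b) + edgeWeight (b, c) = edgeWeight (a, c) := by
  simp only [edgeWeight]
  abel

theorem sum_edgeWeight_apply (l : List (V × V)) (v : V) :
    (l.map edgeWeight).sum v = ((l.map Prod.snd).count v : ℤ) - (l.map Prod.fst).count v := by
  induction l with
  | nil => simp
  | cons p l ih =>
    simp only [List.map_cons, List.sum_cons, Pi.add_apply, ih, edgeWeight, Pi.sub_apply,
      Pi.single_apply, List.count_cons, beq_iff_eq, eq_comm (a := v)]
    split_ifs <;> push_cast <;> ring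

theorem sum_edgeWeight_pathEdges (B v : V) (L : List V) :
    ((pathEdges B (v :: L)).map edgeWeight).sum = edgeWeight (v, B) := by
  induction L generalizing v with
  | nil => simp
  | cons w L ih =>
    rw [pathEdges_cons_cons, List.map_cons, List.sum_cons, ih, edgeWeight_add_edgeWeight]

theorem eq_nil_of_sum_edgeWeight_eq_zero {l : List (V × V)} (hl : ∀ p ∈ l, p.1 < p.2)
    (hsum : (l.map edgeWeight).sum = 0) : l = [] := by
  by_contra hne
  obtain ⟨p, hp, hmax⟩ :=
    l.toFinset.exists_max_image Prod.snd ((List.toFinset_nonempty_iff l).2 hne)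
  simp only [List.mem_toFinset] at hp hmax
  have htarget : 0 < (l.map Prod.snd).count p.2 :=
    List.count_pos_iff.2 (List.mem_map_of_mem hp)
  have hsource : 0 < (l.map Prod.fst).count p.2 := by
    have := sum_edgeWeight_apply l p.2
    rw [hsum, Pi.zero_apply] at this
    omega
  obtain ⟨p', hp', heq⟩ := List.mem_map.1 (List.count_pos_iff.1 hsource)
  exact (hmax p' hp').not_gt (heq ▸ hl p' hp')

theorem exists_perm_cons_of_sum_edgeWeight_eq {a b : V} (hab : a ≠ b) {l : List (V × V)}
    (hsum : (l.map edgeWeight).sum = edgeWeight (a, b)) :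
    ∃ c l', l.Perm ((a, c) :: l') ∧ (l'.map edgeWeight).sum = edgeWeight (c, b) := by
  have hsource : 0 < (l.map Prod.fst).count a := by
    have := sum_edgeWeight_apply l a
    rw [hsum] at this
    simp only [edgeWeight, Pi.sub_apply, Pi.single_apply, hab, if_false, if_true] at this
    omega
  obtain ⟨⟨_, c⟩, hc, rfl⟩ := List.mem_map.1 (List.count_pos_iff.1 hsource)
  have hperm := List.perm_cons_erase hc
  refine ⟨c, _, hperm, ?_⟩
  rw [(hperm.map _).sum_eq, List.map_cons, List.sum_cons,
    ← edgeWeight_add_edgeWeight _ c b] at hsum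
  exact add_left_cancel hsum

theorem perm_pathEdges_of_sum_edgeWeight_eq {a b : V} (hab : a ≠ b) {l : List (V × V)}
    (hl : ∀ p ∈ l, p.1 < p.2) (hsum : (l.map edgeWeight).sum = edgeWeight (a, b)) :
    ∃ L, (a :: L ++ [b]).Pairwise (· < ·) ∧ l.Perm (pathEdges b (a :: L)) := by
  induction hk : l.length generalizing l a with
  | zero =>
    rw [List.length_eq_zero_iff.1 hk] at hsum
    simpa [edgeWeight, hab] using congrFun hsum a
  | succ k ih =>
    obtain ⟨c, l', hperm, hsum'⟩ := exists_perm_cons_of_sum_edgeWeight_eq hab hsum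
    have hl' : ∀ p ∈ (a, c) :: l', p.1 < p.2 := fun p hp => hl p (hperm.mem_iff.2 hp)
    rw [List.forall_mem_cons] at hl'
    obtain ⟨hac, hl'⟩ := hl'
    rcases eq_or_ne c b with rfl | hcb
    · have hnil : l' = [] :=
        eq_nil_of_sum_edgeWeight_eq_zero hl' (hsum'.trans (by simp [edgeWeight]))
      exact ⟨[], by simpa using hac, by rwa [hnil] at hperm⟩
    · have hlength : l'.length = k := by simpa [hk] using hperm.length_eq.symm
      obtain ⟨L, hL, hpath⟩ := ih hcb hl' hsum' hlength
      exact ⟨c :: L, List.pairwise_cons_cons_iff_of_trans.2 ⟨hac, hL⟩, hperm.trans (hpath.cons _)⟩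

theorem perm_or_perm_erase_of_length_le {T S : List V} (hT : T.Nodup) (hS : S.Nodup) (hTS : T ⊆ S)
    (hlength : S.length ≤ T.length + 1) : T.Perm S ∨ ∃ v ∈ S, T.Perm (S.erase v) := by
  by_cases hST : S ⊆ T
  · exact Or.inl ((List.perm_ext_iff_of_nodup hT hS).2 fun v => ⟨@hTS v, @hST v⟩)
  · obtain ⟨v, hvS, hvT⟩ : ∃ v ∈ S, v ∉ T := by simpa [List.subset_def] using hST
    have hsub : (v :: T).Subperm S :=
      List.subperm_of_subset (List.nodup_cons.2 ⟨hvT, hT⟩) (List.cons_subset.2 ⟨hvS, hTS⟩)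
    exact Or.inr ⟨v, hvS,
      ((hsub.perm_of_length_le hlength).trans (List.perm_cons_erase hvS)).cons_inv⟩

end EdgeWeights

section Classification

variable {n : ℕ} {A B : Fin n}

/-- The total weight of the edge `(A, B)` and of all edges into `A`. -/
def sinkWeight (A B : Fin n) : Fin n → ℤ :=
  (((A, B) :: inEdges A (below A)).map edgeWeight).sum

theorem map_fst_inEdges {V : Type*} (A : V) (S : List V) : (inEdges A S).map Prod.fst = S := by
  simp [inEdges, Function.comp_def]

theorem map_snd_inEdges {V : Type*} (A : V) (S : List V) :
    (inEdges A S).map Prod.snd = List.replicate S.length A := by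
  simp [inEdges, Function.comp_def]

theorem inEdges_perm {V : Type*} (A : V) {S S' : List V} (h : S.Perm S') :
    (inEdges A S).Perm (inEdges A S') :=
  h.map _

theorem map_snd_pathEdges {V : Type*} (B v : V) (L : List V) :
    (pathEdges B (v :: L)).map Prod.snd = L ++ [B] :=
  List.map_snd_zip (by simp)

theorem sinkWeight_apply_self (hAB : A ≠ B) : sinkWeight A B A = (A : ℤ) - 1 := by
  have hA : (below A).count A = 0 := List.count_eq_zero.2 fun h => (mem_below.1 h).false
  rw [sinkWeight, sum_edgeWeight_apply, List.map_cons, List.map_cons, map_fst_inEdges,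
    map_snd_inEdges, List.count_cons_of_ne hAB.symm, List.count_cons_self, hA,
    List.count_replicate_self, length_below, zero_add, Nat.cast_one]

theorem exists_filter_snd_eq_inEdges (hAB : A ≠ B) {l : List (Fin n × Fin n)} (hnodup : l.Nodup)
    (hlt : ∀ p ∈ l, p.1 < p.2) (hsum : (l.map edgeWeight).sum = sinkWeight A B) :
    ∃ T, l.filter (fun p => p.2 = A) = inEdges A T
      ∧ (T.Perm (below A) ∨ ∃ v ∈ below A, T.Perm ((below A).erase v)) := by
  set T := (l.filter fun p => p.2 = A).map Prod.fst with hT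
  have hfilter : l.filter (fun p => p.2 = A) = inEdges A T := by
    rw [inEdges, hT, List.map_map]
    refine (List.map_id _).symm.trans (List.map_congr_left fun p hp => ?_)
    exact Prod.ext rfl (of_decide_eq_true (List.mem_filter.1 hp).2)
  have hsub : T ⊆ below A := by
    intro v hv
    obtain ⟨p, hp, rfl⟩ := List.mem_map.1 hv
    simp only [List.mem_filter, decide_eq_true_eq] at hp
    exact mem_below.2 (hp.2 ▸ hlt p hp.1)
  have hcount : (l.map Prod.snd).count A = T.length := by
    rw [hT, List.length_map, List.count, List.countP_map, List.countP_eq_length_filter]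
    rfl
  have hlength : (below A).length ≤ T.length + 1 := by
    have hA := sum_edgeWeight_apply l A
    rw [hsum, sinkWeight_apply_self hAB, hcount] at hA
    rw [length_below]
    omega
  have hTnodup : T.Nodup := by
    refine List.Nodup.of_map (fun v => (v, A)) ?_
    rw [← inEdges, ← hfilter]
    exact hnodup.filter _
  exact ⟨T, hfilter, perm_or_perm_erase_of_length_le hTnodup (nodup_below A) hsub hlength⟩

theorem pairwise_lt_append_of_covBy {V : Type*} [LinearOrder V] {A B : V} (hAB : A ⋖ B)
    {L : List V} (hL : (L ++ [B]).Pairwise (· < ·)) (hA : A ∉ L) :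
    (L ++ [A]).Pairwise (· < ·) := by
  simp only [List.pairwise_append, List.mem_singleton, forall_eq] at hL ⊢
  exact ⟨hL.1, List.pairwise_singleton _ _, fun v hv =>
    (hAB.le_of_lt (hL.2.2 v hv)).lt_of_ne (ne_of_mem_of_not_mem hv hA)⟩

theorem perm_singleton_of_sum_edgeWeight_eq {V : Type*} [LinearOrder V] {A B : V} (hAB : A ⋖ B)
    {l : List (V × V)} (hlt : ∀ p ∈ l, p.1 < p.2)
    (hsum : (l.map edgeWeight).sum = edgeWeight (A, B)) : l.Perm [(A, B)] := by
  obtain ⟨L, hL, hpath⟩ := perm_pathEdges_of_sum_edgeWeight_eq hAB.lt.ne hlt hsum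
  cases L with
  | nil => exact hpath
  | cons w L =>
    exact absurd (List.rel_of_pairwise_cons hL.of_cons (by simp))
      (hAB.2 (List.rel_of_pairwise_cons hL (by simp)))

theorem perm_pathEdges_of_forall_snd_ne {V : Type*} [LinearOrder V] {A B v : V} (hAB : A ⋖ B)
    (hv : v < A) {l : List (V × V)} (hlt : ∀ p ∈ l, p.1 < p.2) (hA : ∀ p ∈ l, p.2 ≠ A)
    (hsum : (l.map edgeWeight).sum = edgeWeight (v, B)) :
    ∃ L, (v :: L ++ [A]).Pairwise (· < ·) ∧ l.Perm (pathEdges B (v :: L)) := by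
  obtain ⟨L, hL, hpath⟩ := perm_pathEdges_of_sum_edgeWeight_eq (hv.trans hAB.lt).ne hlt hsum
  have hAL : A ∉ v :: L := by
    refine List.not_mem_cons_of_ne_of_not_mem hv.ne' fun hmem => ?_
    have htarget : A ∈ l.map Prod.snd := by
      rw [(hpath.map _).mem_iff, map_snd_pathEdges]
      exact List.mem_append_left _ hmem
    obtain ⟨p, hp, hpA⟩ := List.mem_map.1 htarget
    exact hA p hp hpA
  exact ⟨L, pairwise_lt_append_of_covBy hAB hL hAL, hpath⟩

theorem perm_of_sum_edgeWeight_eq_sinkWeight (hAB : A ⋖ B) {l : List (Fin n × Fin n)}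
    (hnodup : l.Nodup) (hlt : ∀ p ∈ l, p.1 < p.2)
    (hsum : (l.map edgeWeight).sum = sinkWeight A B) :
    l.Perm ((A, B) :: inEdges A (below A))
      ∨ ∃ v L, (v :: L ++ [A]).Pairwise (· < ·)
          ∧ l.Perm (pathEdges B (v :: L) ++ inEdges A ((below A).erase v)) := by
  obtain ⟨T, hT, hTbelow⟩ := exists_filter_snd_eq_inEdges hAB.lt.ne hnodup hlt hsum
  set rest := l.filter fun p => !decide (p.2 = A)
  have hperm : l.Perm (rest ++ inEdges A T) := by
    rw [← hT]
    exact (List.filter_append_perm _ l).symm.trans List.perm_append_comm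
  have hrest_lt : ∀ p ∈ rest, p.1 < p.2 := fun p hp => hlt p (List.mem_filter.1 hp).1
  have hrest_ne : ∀ p ∈ rest, p.2 ≠ A := fun p hp => by simpa using (List.mem_filter.1 hp).2
  have hsplit : (rest.map edgeWeight).sum + ((inEdges A T).map edgeWeight).sum
      = edgeWeight (A, B) + ((inEdges A (below A)).map edgeWeight).sum := by
    rw [← List.sum_append, ← List.map_append, ← (hperm.map _).sum_eq, hsum, sinkWeight,
      List.map_cons, List.sum_cons]
  rcases hTbelow with hTbelow | ⟨v, hv, hTbelow⟩
  · left
    rw [((inEdges_perm A hTbelow).map edgeWeight).sum_eq] at hsplit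
    exact hperm.trans ((perm_singleton_of_sum_edgeWeight_eq hAB hrest_lt
      (add_right_cancel hsplit)).append (inEdges_perm A hTbelow))
  · right
    rw [((inEdges_perm A hTbelow).map edgeWeight).sum_eq,
      ((inEdges_perm A (List.perm_cons_erase hv)).map edgeWeight).sum_eq, inEdges, inEdges,
      List.map_cons, List.map_cons, List.sum_cons, ← add_assoc, add_comm (edgeWeight (A, B)),
      edgeWeight_add_edgeWeight] at hsplit
    obtain ⟨L, hL, hpath⟩ := perm_pathEdges_of_forall_snd_ne hAB (mem_below.1 hv) hrest_lt hrest_ne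
      (add_right_cancel hsplit)
    exact ⟨v, L, hL, hperm.trans (hpath.append (inEdges_perm A hTbelow))⟩

end Classification

section Spanning

attribute [local instance] LieRing.ofAssociativeRing

variable {n : ℕ} {A B : Fin n}

theorem root_eq_edgeWeight (s : Pos n) : root s = edgeWeight s.1 := by
  ext i
  simp [root, edgeWeight, Pi.single_apply, eq_comm]

theorem weight_eq_sum_edgeWeight {k : ℕ} (p : Fin k → Pos n) :
    weight p = ((List.ofFn fun m => (p m).1).map edgeWeight).sum := by
  induction k with
  | zero => ext i; simp [weight]
  | succ k ih =>
    rw [weight_succ, ih, root_eq_edgeWeight, List.ofFn_succ, List.map_cons, List.sum_cons]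

theorem ιMulti_eq_wedgeEdges {k : ℕ} (p : Fin k → Pos n) :
    ExteriorAlgebra.ιMulti ℤ k (fun m => e (p m)) = wedgeEdges (List.ofFn fun m => (p m).1) := by
  simp only [ιMulti_eq_wedgeList, wedgeEdges, List.map_ofFn, e_eq_edge, Function.comp_def]

theorem wedgeEdges_mem_weightSpan (l : List (Fin n × Fin n)) :
    wedgeEdges l ∈ weightSpan n (l.map edgeWeight).sum l.length := by
  induction l with
  | nil =>
    refine Submodule.subset_span ⟨Fin.elim0, ?_, by simp⟩
    simp [weight_eq_sum_edgeWeight]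
  | cons p l ih =>
    rw [wedgeEdges_cons, List.map_cons, List.sum_cons, List.length_cons]
    by_cases hp : p.1 < p.2
    · rw [edge_of_lt hp, ← root_eq_edgeWeight ⟨p, hp⟩]
      exact ι_mul_mem_weightSpan _ ih
    · rw [edge, dif_neg hp, map_zero, zero_mul]
      exact zero_mem _

theorem pathGen_mem_iff {v : Fin n} (hv : v < A) (L : List (Fin n))
    (N : Submodule ℤ (ExteriorAlgebra ℤ (nil n))) :
    pathGen A B v L ∈ N
      ↔ wedgeEdges (pathEdges B (v :: L) ++ inEdges A ((below A).erase v)) ∈ N := by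
  rw [pathGen, wedgeEdges_append]
  rcases inStarFace_eq_wedgeEdges_or_neg hv with h | h
  · rw [h]
  · rw [h, mul_neg, neg_mem_iff]

/-- The generators of the part of degree `k` of the complex of wedges of weight `sinkWeight A B`;
see `weightSpan_sinkWeight`. -/
def generators (A B : Fin n) (k : ℕ) : Set (ExteriorAlgebra ℤ (nil n)) :=
  {a | ∃ v L, (v :: L ++ [A]).Pairwise (· < ·) ∧ L.length + A = k ∧ a = pathGen A B v L}
    ∪ {a | k = A + 1 ∧ a = apexGen A B}

theorem pathGen_mem_generators {v : Fin n} {L : List (Fin n)}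
    (hL : (v :: L ++ [A]).Pairwise (· < ·)) : pathGen A B v L ∈ generators A B (L.length + A) :=
  Or.inl ⟨v, L, hL, rfl, rfl⟩

theorem apexGen_mem_generators : apexGen A B ∈ generators A B (A + 1) := Or.inr ⟨rfl, rfl⟩

theorem length_pathEdges_append_inEdges {v : Fin n} (hv : v < A) (L : List (Fin n)) :
    (pathEdges B (v :: L) ++ inEdges A ((below A).erase v)).length = L.length + A := by
  have hlength := (List.perm_cons_erase (mem_below.2 hv)).length_eq
  rw [length_below, List.length_cons] at hlength
  rw [List.length_append, length_pathEdges, inEdges, List.length_map, List.length_cons]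
  omega

theorem sum_edgeWeight_pathEdges_append_inEdges {v : Fin n} (hv : v < A) (L : List (Fin n)) :
    ((pathEdges B (v :: L) ++ inEdges A ((below A).erase v)).map edgeWeight).sum
      = sinkWeight A B := by
  rw [sinkWeight, List.map_append, List.sum_append, sum_edgeWeight_pathEdges, List.map_cons,
    List.sum_cons, ((inEdges_perm A (List.perm_cons_erase (mem_below.2 hv))).map edgeWeight).sum_eq,
    inEdges, inEdges, List.map_cons, List.map_cons, List.sum_cons, ← add_assoc,
    add_comm (edgeWeight (A, B)), edgeWeight_add_edgeWeight]

theorem generators_subset_weightSpan (k : ℕ) :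
    generators A B k ⊆ weightSpan n (sinkWeight A B) k := by
  rintro _ (⟨v, L, hL, rfl, rfl⟩ | ⟨rfl, rfl⟩)
  · have hv : v < A := lt_of_mem_of_pairwise_append hL (by simp)
    rw [SetLike.mem_coe, pathGen_mem_iff hv, ← sum_edgeWeight_pathEdges_append_inEdges hv L,
      ← length_pathEdges_append_inEdges hv L]
    exact wedgeEdges_mem_weightSpan _
  · have hmem := wedgeEdges_mem_weightSpan ((A, B) :: inEdges A (below A))
    rwa [List.length_cons, inEdges, List.length_map, length_below] at hmem

theorem wedgeEdges_mem_span_generators (hAB : A ⋖ B) {l : List (Fin n × Fin n)}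
    (hnodup : l.Nodup) (hlt : ∀ p ∈ l, p.1 < p.2)
    (hsum : (l.map edgeWeight).sum = sinkWeight A B) :
    wedgeEdges l ∈ Submodule.span ℤ (generators A B l.length) := by
  rcases perm_of_sum_edgeWeight_eq_sinkWeight hAB hnodup hlt hsum with hl | ⟨v, L, hL, hl⟩
  · rw [wedgeEdges_mem_iff_of_perm hl, hl.length_eq, List.length_cons, inEdges, List.length_map,
      length_below]
    exact Submodule.subset_span apexGen_mem_generators
  · have hv : v < A := lt_of_mem_of_pairwise_append hL (by simp)
    rw [wedgeEdges_mem_iff_of_perm hl, hl.length_eq, length_pathEdges_append_inEdges hv,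
      ← pathGen_mem_iff hv]
    exact Submodule.subset_span (pathGen_mem_generators hL)

theorem weightSpan_sinkWeight (hAB : A ⋖ B) (k : ℕ) :
    weightSpan n (sinkWeight A B) k = Submodule.span ℤ (generators A B k) := by
  refine le_antisymm (Submodule.span_le.2 ?_) (Submodule.span_le.2 (generators_subset_weightSpan k))
  rintro _ ⟨p, hp, rfl⟩
  by_cases hinj : Function.Injective p
  · have hmem := wedgeEdges_mem_span_generators hAB (l := List.ofFn fun m => (p m).1)
      (List.nodup_ofFn.2 (Subtype.val_injective.comp hinj))
      (List.forall_mem_ofFn_iff.2 fun m => (p m).2) (by rw [← hp, weight_eq_sum_edgeWeight])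
    rwa [← ιMulti_eq_wedgeEdges, List.length_ofFn] at hmem
  · rw [AlternatingMap.map_eq_zero_of_not_injective _ (fun m => e (p m))
      fun h => hinj (Function.Injective.of_comp (f := e) h)]
    exact zero_mem _

theorem unmodify_torsionWeight {q : ℕ} (hn : q + 2 ≤ n) :
    unmodify (torsionWeight q n) = sinkWeight (⟨q, by omega⟩ : Fin n) ⟨q + 1, by omega⟩ := by
  ext i
  rw [sinkWeight, sum_edgeWeight_apply, List.map_cons, List.map_cons, map_fst_inEdges,
    map_snd_inEdges, length_below, List.count_cons, List.count_cons, List.count_replicate,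
    (nodup_below _).count, unmodify, torsionWeight]
  simp only [mem_below, beq_iff_eq, Fin.lt_def, Fin.ext_iff]
  split_ifs <;> omega

end Spanning

section TwoTermRetraction

variable {R M : Type*} [CommRing R] [AddCommGroup M] [Module R M] {D s : M →ₗ[R] M}
  {C : ℕ → Submodule R M} {ε η : M →ₗ[R] R} {g α : M} {d : ℕ} {r : R}

/-- The homotopy `s` retracts the complex with modules `C k` and differential `D` to the complex
`R • α → R • g`, in degrees `d + 1` and `d`, whose differential is multiplication by `r`; the
coefficients of the retraction are `ε` at `g` and `η` at `α`. -/
structure IsTwoTermRetraction (D s : M →ₗ[R] M) (C : ℕ → Submodule R M) (ε η : M →ₗ[R] R) (g α : M)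
    (d : ℕ) (r : R) : Prop where
  homotopy_mem : ∀ k, ∀ a ∈ C k, s a ∈ C (k + 1)
  homotopy : ∀ k, ∀ a ∈ C k, D (s a) + s (D a) = a - ε a • g - η a • α
  ε_eq_zero : ∀ k ≠ d, ∀ a ∈ C k, ε a = 0
  η_eq_zero : ∀ a ∈ C d, η a = 0
  g_mem : g ∈ C d
  α_mem : α ∈ C (d + 1)
  ε_g : ε g = 1
  D_g : D g = 0
  D_α : D α = r • g

namespace IsTwoTermRetraction

variable (h : IsTwoTermRetraction D s C ε η g α d r) (hD : ∀ a, D (D a) = 0)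

include h hD

theorem D_homotopy_D {k : ℕ} {a : M} (ha : a ∈ C k) : D (s (D a)) = D a - (η a * r) • g := by
  have := congrArg D (h.homotopy k a ha)
  rwa [map_add, hD, zero_add, map_sub, map_sub, map_smul, map_smul, h.D_g, h.D_α, smul_zero,
    sub_zero, smul_smul] at this

theorem exists_D_eq_of_ne (hr : r ∈ nonZeroDivisors R) {k : ℕ} (hk : k ≠ d) {a : M} (ha : a ∈ C k)
    (hDa : D a = 0) : ∃ b ∈ C (k + 1), D b = a := by
  have hη : η a = 0 := by
    have hg := h.D_homotopy_D hD ha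
    rw [hDa, map_zero, map_zero, zero_sub, eq_comm, neg_eq_zero] at hg
    have hε := congrArg ε hg
    rw [map_smul, h.ε_g, smul_eq_mul, mul_one, map_zero] at hε
    exact (mul_right_mem_nonZeroDivisors_eq_zero_iff hr).1 hε
  have ha' := h.homotopy k a ha
  rw [hDa, map_zero, add_zero, h.ε_eq_zero k hk a ha, hη, zero_smul, zero_smul, sub_zero,
    sub_zero] at ha'
  exact ⟨s a, h.homotopy_mem k a ha, ha'⟩

theorem ε_D (hC : ∀ k, ∀ a ∈ C (k + 1), D a ∈ C k) {b : M} (hb : b ∈ C (d + 1)) :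
    ε (D b) = η b * r := by
  have hDb := hC d b hb
  have hhom := h.homotopy d _ hDb
  rw [hD, map_zero, add_zero, h.D_homotopy_D hD hb, h.η_eq_zero _ hDb, zero_smul, sub_zero] at hhom
  have hε := congrArg ε (sub_right_inj.1 hhom)
  rwa [map_smul, map_smul, h.ε_g, smul_eq_mul, smul_eq_mul, mul_one, mul_one, eq_comm] at hε

theorem exists_D_eq_iff (hC : ∀ k, ∀ a ∈ C (k + 1), D a ∈ C k) {a : M} (ha : a ∈ C d)
    (hDa : D a = 0) : (∃ b ∈ C (d + 1), D b = a) ↔ r ∣ ε a := by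
  constructor
  · rintro ⟨b, hb, rfl⟩
    exact ⟨η b, (h.ε_D hD hC hb).trans (mul_comm _ _)⟩
  · rintro ⟨c, hc⟩
    refine ⟨s a + c • α, add_mem (h.homotopy_mem d a ha) (Submodule.smul_mem _ c h.α_mem), ?_⟩
    have hhom := h.homotopy d a ha
    rw [hDa, map_zero, add_zero, h.η_eq_zero a ha, zero_smul, sub_zero] at hhom
    rw [map_add, hhom, map_smul, h.D_α, smul_smul, hc, mul_comm c r, sub_add_cancel]

end IsTwoTermRetraction

end TwoTermRetraction

section Homology

variable {R : Type u} [CommRing R]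

theorem nonempty_homology_linearEquiv (S : ShortComplex (ModuleCat.{v} R)) {N : Type*}
    [AddCommGroup N] [Module R N] (φ : S.X₂ →ₗ[R] N) (hsurj : ∀ m, ∃ a, S.g a = 0 ∧ φ a = m)
    (hφ : ∀ a, S.g a = 0 → (φ a = 0 ↔ ∃ b, S.f b = a)) : Nonempty (S.homology ≃ₗ[R] N) := by
  let ψ : LinearMap.ker S.g.hom →ₗ[R] N := φ ∘ₗ (LinearMap.ker S.g.hom).subtype
  have hψ : Function.Surjective ψ := fun m => by
    obtain ⟨a, ha, hm⟩ := hsurj m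
    exact ⟨⟨a, ha⟩, hm⟩
  have hrange : LinearMap.range S.moduleCatToCycles = LinearMap.ker ψ := by
    ext ⟨a, ha⟩
    refine Iff.trans (exists_congr fun b => ?_) (hφ a ha).symm
    exact Subtype.ext_iff
  exact ⟨S.moduleCatHomologyIso.toLinearEquiv ≪≫ₗ Submodule.quotEquivOfEq _ _ hrange ≪≫ₗ
    ψ.quotKerEquivOfSurjective hψ⟩

theorem exists_nonempty_iso_prod_of_isSplitMono {X Y : ModuleCat.{v} R} (f : X ⟶ Y)
    [IsSplitMono f] : ∃ A : ModuleCat.{v} R, Nonempty (Y ≅ ModuleCat.of R (X × A)) := by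
  have hretraction : (retraction f).hom ∘ₗ f.hom = LinearMap.id :=
    congrArg ModuleCat.Hom.hom (IsSplitMono.id f)
  exact ⟨ModuleCat.of R (Y ⧸ LinearMap.range f.hom),
    ⟨(lequivProdOfLeftSplitExact (LinearMap.range f.hom).mkQ_surjective
      (LinearMap.range f.hom).ker_mkQ.symm hretraction).symm.toModuleIso⟩⟩

variable {L : Type v} [LieRing L] [LieAlgebra R L]
  {C : ℕ → Submodule R (ExteriorAlgebra R L)}
  (hC : ∀ k, ∀ a ∈ C (k + 1), boundary R L a ∈ C k)

theorem complexOf_d (k : ℕ) :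
    (complexOf C hC).d (k + 1) k = ModuleCat.ofHom ((boundary R L).restrict (hC k)) :=
  ChainComplex.of_d (fun k => ModuleCat.of R (C k))
    (fun k => ModuleCat.ofHom ((boundary R L).restrict (hC k))) k

theorem subsingleton_complexOf_homology_of_eq_bot {k : ℕ} (hk : C k = ⊥) :
    Subsingleton ((complexOf C hC).homology k) := by
  have hX : Subsingleton (C k) := by rw [hk]; infer_instance
  exact ModuleCat.subsingleton_of_isZero (HomologicalComplex.ExactAt.of_isZero
    (ModuleCat.isZero_of_subsingleton (ModuleCat.of R (C k)))).isZero_homology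

theorem nonempty_complexOf_homology_linearEquiv {k : ℕ} {N : Type*} [AddCommGroup N] [Module R N]
    (φ : ExteriorAlgebra R L →ₗ[R] N)
    (hsurj : ∀ m, ∃ a ∈ C (k + 1), boundary R L a = 0 ∧ φ a = m)
    (hφ : ∀ a ∈ C (k + 1), boundary R L a = 0 →
      (φ a = 0 ↔ ∃ b ∈ C (k + 2), boundary R L b = a)) :
    Nonempty ((complexOf C hC).homology (k + 1) ≃ₗ[R] N) := by
  have hd (j : ℕ) (b : C (j + 1)) (a : C j) :
      (complexOf C hC).d (j + 1) j b = a ↔ boundary R L b = a := by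
    rw [complexOf_d hC j]
    exact Subtype.ext_iff
  obtain ⟨f⟩ := nonempty_homology_linearEquiv ((complexOf C hC).sc' (k + 2) (k + 1) k)
    (φ ∘ₗ (C (k + 1)).subtype)
    (fun m => by
      obtain ⟨a, ha, hda, hm⟩ := hsurj m
      exact ⟨(⟨a, ha⟩ : C (k + 1)), (hd k _ 0).2 hda, hm⟩)
    (fun a hda => (hφ a.1 a.2 ((hd k a 0).1 hda)).trans
      ⟨fun ⟨b, hb, hba⟩ => ⟨(⟨b, hb⟩ : C (k + 2)), (hd (k + 1) _ a).2 hba⟩,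
        fun ⟨b, hba⟩ => ⟨b.1, b.2, (hd (k + 1) b a).1 hba⟩⟩)
  exact ⟨(ShortComplex.homologyMapIso ((complexOf C hC).isoSc' (k + 2) (k + 1) k
    (by simp) (by simp))).toLinearEquiv ≪≫ₗ f⟩

variable {s : ExteriorAlgebra R L →ₗ[R] ExteriorAlgebra R L} {ε η : ExteriorAlgebra R L →ₗ[R] R}
  {g α : ExteriorAlgebra R L} {d : ℕ} {r : R}

theorem IsTwoTermRetraction.subsingleton_complexOf_homology
    (h : IsTwoTermRetraction (boundary R L) s C ε η g α d r) (hr : r ∈ nonZeroDivisors R)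
    (hC₀ : C 0 = ⊥) {k : ℕ} (hk : k ≠ d) : Subsingleton ((complexOf C hC).homology k) := by
  cases k with
  | zero => exact subsingleton_complexOf_homology_of_eq_bot hC hC₀
  | succ k =>
    obtain ⟨f⟩ := nonempty_complexOf_homology_linearEquiv hC
      (0 : ExteriorAlgebra R L →ₗ[R] PUnit) (fun _ => ⟨0, zero_mem _, map_zero _, rfl⟩)
      fun a ha hda => iff_of_true rfl (h.exists_D_eq_of_ne boundary_boundary hr hk ha hda)
    exact f.toEquiv.subsingleton

theorem IsTwoTermRetraction.nonempty_complexOf_homology_linearEquiv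
    (h : IsTwoTermRetraction (boundary R L) s C ε η g α d r) (hd : d ≠ 0) :
    Nonempty ((complexOf C hC).homology d ≃ₗ[R] R ⧸ Ideal.span {r}) := by
  obtain ⟨k, rfl⟩ := Nat.exists_eq_succ_of_ne_zero hd
  refine LieHomology.nonempty_complexOf_homology_linearEquiv hC
    ((Ideal.span {r}).mkQ ∘ₗ ε) (fun m => ?_) fun a ha hda => ?_
  · obtain ⟨c, rfl⟩ := (Ideal.span {r}).mkQ_surjective m
    refine ⟨c • g, Submodule.smul_mem _ c h.g_mem, ?_, ?_⟩
    · rw [map_smul, h.D_g, smul_zero]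
    · rw [LinearMap.comp_apply, map_smul, h.ε_g, smul_eq_mul, mul_one]
  · rw [LinearMap.comp_apply, Submodule.mkQ_apply, Submodule.Quotient.mk_eq_zero,
      Ideal.mem_span_singleton]
    exact (h.exists_D_eq_iff boundary_boundary hC ha hda).symm

end Homology

section Retraction

attribute [local instance] LieRing.ofAssociativeRing

variable {n : ℕ} {A B o : Fin n}

theorem generators_eq_empty {k : ℕ} (hk : k < A) : generators A B k = ∅ := by
  refine Set.eq_empty_of_forall_notMem ?_
  rintro _ (⟨v, L, -, hlength, -⟩ | ⟨hlength, -⟩) <;> omega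

theorem prepend_mem_weightSpan (ho : IsBot o) (hAB : A ⋖ B) {k : ℕ} {a : ExteriorAlgebra ℤ (nil n)}
    (ha : a ∈ weightSpan n (sinkWeight A B) k) :
    prepend A o a ∈ weightSpan n (sinkWeight A B) (k + 1) := by
  suffices weightSpan n (sinkWeight A B) k
      ≤ (weightSpan n (sinkWeight A B) (k + 1)).comap (prepend A o) from this ha
  rw [weightSpan_sinkWeight hAB, Submodule.span_le]
  rintro _ (⟨v, L, hL, rfl, rfl⟩ | ⟨rfl, rfl⟩)
  · rw [SetLike.mem_coe, Submodule.mem_comap]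
    rcases (ho v).eq_or_lt with rfl | hov
    · rw [prepend_pathGen_self hAB.lt hL]
      exact zero_mem _
    · rw [prepend_pathGen hov hAB.lt hL, add_right_comm]
      refine generators_subset_weightSpan _ (pathGen_mem_generators (L := v :: L) ?_)
      exact List.pairwise_cons_cons_iff_of_trans.2 ⟨hov, hL⟩
  · rw [SetLike.mem_coe, Submodule.mem_comap, prepend_apexGen o hAB.lt]
    exact zero_mem _

theorem boundary_prepend_pathGen_nil (ho : IsBot o) {v : Fin n} (hv : v < A) (hAB : A < B) :
    boundary ℤ (nil n) (prepend A o (pathGen A B v [])) = pathGen A B v [] - pathGen A B o [] := by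
  rcases (ho v).eq_or_lt with rfl | hov
  · rw [prepend_pathGen_self hAB (by simpa using hv), map_zero, sub_self]
  · rw [prepend_pathGen hov hAB (by simpa using hv), boundary_pathGen_singleton hov hv hAB]

/-- The apex generator, corrected so that its boundary is a multiple of `pathGen A B o []`. -/
noncomputable def correctedApex (A B o : Fin n) : ExteriorAlgebra ℤ (nil n) :=
  apexGen A B - prepend A o (boundary ℤ (nil n) (apexGen A B))

theorem boundary_correctedApex (ho : IsBot o) (hAB : A < B) :
    boundary ℤ (nil n) (correctedApex A B o) = (A : ℤ) • pathGen A B o [] := by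
  rw [correctedApex, map_sub, boundary_apexGen hAB, map_sum, map_sum,
    Finset.sum_congr rfl fun v hv => boundary_prepend_pathGen_nil ho (Finset.mem_Iio.1 hv) hAB,
    Finset.sum_sub_distrib, sub_sub_cancel, Finset.sum_const, Fin.card_Iio, natCast_zsmul]

theorem homotopy_prepend (ho : IsBot o) (hAB : A ⋖ B) {k : ℕ} {a : ExteriorAlgebra ℤ (nil n)}
    (ha : a ∈ weightSpan n (sinkWeight A B) k) :
    boundary ℤ (nil n) (prepend A o a) + prepend A o (boundary ℤ (nil n) a)
      = a - augmentation A B a • pathGen A B o [] - apexCoeff A B a • correctedApex A B o := by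
  rw [weightSpan_sinkWeight hAB] at ha
  refine LinearMap.eqOn_span
    (f := boundary ℤ (nil n) ∘ₗ prepend A o + prepend A o ∘ₗ boundary ℤ (nil n))
    (g := LinearMap.id - (augmentation A B).smulRight (pathGen A B o [])
      - (apexCoeff A B).smulRight (correctedApex A B o)) ?_ ha
  rintro _ (⟨v, L, hL, -, rfl⟩ | ⟨-, rfl⟩)
  · simp only [LinearMap.add_apply, LinearMap.sub_apply, LinearMap.comp_apply, LinearMap.id_apply,
      LinearMap.smulRight_apply, apexCoeff_pathGen hAB.lt hL, zero_smul, sub_zero]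
    cases L with
    | nil =>
      have hv : v < A := lt_of_mem_of_pairwise_append hL (by simp)
      rw [boundary_prepend_pathGen_nil ho hv hAB.lt, boundary_pathGen_nil hv hAB.lt, map_zero,
        add_zero, augmentation_pathGen_nil hv hAB.lt, one_smul]
    | cons w L =>
      have hw : w < A := lt_of_mem_of_pairwise_append hL (by simp)
      rw [boundary_prepend_add_prepend_boundary_pathGen ho hAB.lt hL,
        augmentation_pathGen_cons hAB.lt hw, zero_smul, sub_zero]
  · simp only [LinearMap.add_apply, LinearMap.sub_apply, LinearMap.comp_apply, LinearMap.id_apply,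
      LinearMap.smulRight_apply, augmentation_apexGen, apexCoeff_apexGen hAB.lt, zero_smul,
      one_smul, sub_zero, correctedApex, prepend_apexGen o hAB.lt, map_zero, zero_add,
      sub_sub_cancel]

theorem augmentation_eq_zero (hAB : A ⋖ B) {k : ℕ} (hk : k ≠ A) {a : ExteriorAlgebra ℤ (nil n)}
    (ha : a ∈ weightSpan n (sinkWeight A B) k) : augmentation A B a = 0 := by
  suffices weightSpan n (sinkWeight A B) k ≤ LinearMap.ker (augmentation A B) from this ha
  rw [weightSpan_sinkWeight hAB, Submodule.span_le]
  rintro _ (⟨v, _ | ⟨w, L⟩, hL, rfl, rfl⟩ | ⟨-, rfl⟩)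
  · exact absurd (zero_add _) hk
  · exact augmentation_pathGen_cons hAB.lt (lt_of_mem_of_pairwise_append hL (by simp))
  · exact augmentation_apexGen

theorem apexCoeff_eq_zero (hAB : A ⋖ B) {a : ExteriorAlgebra ℤ (nil n)}
    (ha : a ∈ weightSpan n (sinkWeight A B) A) : apexCoeff A B a = 0 := by
  suffices weightSpan n (sinkWeight A B) A ≤ LinearMap.ker (apexCoeff A B) from this ha
  rw [weightSpan_sinkWeight hAB, Submodule.span_le]
  rintro _ (⟨v, L, hL, -, rfl⟩ | ⟨h, -⟩)
  · exact apexCoeff_pathGen hAB.lt hL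
  · exact absurd h (Nat.succ_ne_self A).symm

theorem isTwoTermRetraction_prepend (ho : IsBot o) (hoA : o < A) (hAB : A ⋖ B) :
    IsTwoTermRetraction (boundary ℤ (nil n)) (prepend A o) (weightSpan n (sinkWeight A B))
      (augmentation A B) (apexCoeff A B) (pathGen A B o []) (correctedApex A B o) A A where
  homotopy_mem _ _ ha := prepend_mem_weightSpan ho hAB ha
  homotopy _ _ ha := homotopy_prepend ho hAB ha
  ε_eq_zero _ hk _ ha := augmentation_eq_zero hAB hk ha
  η_eq_zero _ ha := apexCoeff_eq_zero hAB ha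
  g_mem := by
    simpa using generators_subset_weightSpan _
      (pathGen_mem_generators (B := B) (v := o) (L := []) (by simpa using hoA))
  α_mem :=
    have hapex := generators_subset_weightSpan (A + 1) (apexGen_mem_generators (A := A) (B := B))
    sub_mem hapex (prepend_mem_weightSpan ho hAB (boundary_mem_weightSpan _ _ _ hapex))
  ε_g := augmentation_pathGen_nil hoA hAB.lt
  D_g := boundary_pathGen_nil hoA hAB.lt
  D_α := boundary_correctedApex ho hAB.lt

end Retraction

section Bracket

variable {q n : ℕ}

theorem isTwoTermRetraction_torsionWeight (hq : 0 < q) (hn : q + 2 ≤ n) :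
    ∃ s ε η g α, IsTwoTermRetraction (boundary ℤ (nil n)) s
      (weightSpan n (unmodify (torsionWeight q n))) ε η g α q (q : ℤ) := by
  rw [unmodify_torsionWeight hn]
  exact ⟨_, _, _, _, _, isTwoTermRetraction_prepend (o := ⟨0, by omega⟩)
    (A := ⟨q, by omega⟩) (B := ⟨q + 1, by omega⟩) (fun i => Nat.zero_le i) hq
    (Fin.covBy_iff.2 (Order.covBy_add_one q))⟩

theorem weightSpan_torsionWeight_zero (hq : 0 < q) (hn : q + 2 ≤ n) :
    weightSpan n (unmodify (torsionWeight q n)) 0 = ⊥ := by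
  rw [unmodify_torsionWeight hn, weightSpan_sinkWeight (Fin.covBy_iff.2 (Order.covBy_add_one q)),
    generators_eq_empty hq, Submodule.span_empty]

theorem subsingleton_homology_bracket_torsionWeight (hq : 0 < q) (hn : q + 2 ≤ n) {k : ℕ}
    (hk : k ≠ q) : Subsingleton ((bracket (torsionWeight q n)).homology k) := by
  obtain ⟨_, _, _, _, _, h⟩ := isTwoTermRetraction_torsionWeight hq hn
  exact h.subsingleton_complexOf_homology
    (boundary_mem_weightSpan (unmodify (torsionWeight q n)))
    (mem_nonZeroDivisors_of_ne_zero (by exact_mod_cast hq.ne'))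
    (weightSpan_torsionWeight_zero hq hn) hk

theorem nonempty_homology_bracket_torsionWeight_addEquiv (hq : 0 < q) (hn : q + 2 ≤ n) :
    Nonempty ((bracket (torsionWeight q n)).homology q ≃+ ZMod q) := by
  obtain ⟨_, _, _, _, _, h⟩ := isTwoTermRetraction_torsionWeight hq hn
  obtain ⟨f⟩ := h.nonempty_complexOf_homology_linearEquiv
    (boundary_mem_weightSpan (unmodify (torsionWeight q n))) hq.ne'
  exact ⟨f.toAddEquiv.trans (Int.quotientSpanNatEquivZMod q).toAddEquiv⟩

end Bracket

section WeightProjection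

attribute [local instance] LieRing.ofAssociativeRing

variable {n : ℕ}

theorem eq_sum_entry_smul_e (x : nil n) : x = ∑ s : Pos n, entry s.1.1 s.1.2 x • e s := by
  refine Subtype.ext (Matrix.ext fun i j => ?_)
  change x.1 i j = entry i j (∑ s : Pos n, entry s.1.1 s.1.2 x • e s)
  by_cases hij : i < j
  · rw [map_sum, Finset.sum_eq_single ⟨(i, j), hij⟩ _ (by simp), map_smul, e_eq_edge,
      entry_edge_self hij, smul_eq_mul, mul_one, entry_apply]
    intro s _ hs
    rw [map_smul, e_eq_edge, entry_edge_of_ne fun h => hs (Subtype.ext (Prod.ext h.1 h.2)),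
      smul_zero]
  · rw [entry_apply, x.2 i j (not_lt.1 hij),
      (∑ s : Pos n, entry s.1.1 s.1.2 x • e s).2 i j (not_lt.1 hij)]

theorem span_range_e : Submodule.span ℤ (Set.range (e : Pos n → nil n)) = ⊤ := by
  refine eq_top_iff.2 fun x _ => ?_
  rw [eq_sum_entry_smul_e x]
  exact sum_mem fun s _ => Submodule.smul_mem _ _ (Submodule.subset_span ⟨s, rfl⟩)

theorem sum_mul_sum_eq_zero {S ι : Type*} [NonUnitalNonAssocSemiring S] (s : Finset ι) (f : ι → S)
    (h : ∀ i, f i * f i = 0) (h' : ∀ i j, f i * f j + f j * f i = 0) :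
    (∑ i ∈ s, f i) * ∑ i ∈ s, f i = 0 := by
  classical
  induction s using Finset.induction_on with
  | empty => simp
  | insert i s hi ih =>
    have hs : f i * ∑ j ∈ s, f j + (∑ j ∈ s, f j) * f i = 0 := by
      rw [Finset.mul_sum, Finset.sum_mul, ← Finset.sum_add_distrib]
      exact Finset.sum_eq_zero fun j _ => h' i j
    rw [Finset.sum_insert hi, add_mul, mul_add, mul_add, h, ih, zero_add, add_zero, hs]

/-- The linear map `e s ↦ e s ⊗ [root s]` from `nil n` to the group algebra of the weight lattice
over the exterior algebra. -/
noncomputable def gradedι (n : ℕ) :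
    nil n →ₗ[ℤ] AddMonoidAlgebra (ExteriorAlgebra ℤ (nil n)) (Fin n → ℤ) :=
  ∑ s : Pos n, (entry s.1.1 s.1.2).smulRight
    (AddMonoidAlgebra.single (root s) (ExteriorAlgebra.ι ℤ (e s)))

theorem gradedι_apply (x : nil n) : gradedι n x = ∑ s : Pos n, entry s.1.1 s.1.2 x •
    AddMonoidAlgebra.single (root s) (ExteriorAlgebra.ι ℤ (e s)) := by
  simp [gradedι]

theorem gradedι_e (s : Pos n) :
    gradedι n (e s) = AddMonoidAlgebra.single (root s) (ExteriorAlgebra.ι ℤ (e s)) := by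
  rw [gradedι_apply, Finset.sum_eq_single s _ (by simp), e_eq_edge, entry_edge_self s.2, one_smul]
  intro t _ hts
  rw [e_eq_edge, entry_edge_of_ne fun h => hts (Subtype.ext (Prod.ext h.1 h.2)).symm, zero_smul]

theorem gradedι_mul_self (x : nil n) : gradedι n x * gradedι n x = 0 := by
  rw [gradedι_apply]
  refine sum_mul_sum_eq_zero _ _ (fun s => ?_) fun s t => ?_
  · rw [smul_mul_smul_comm, AddMonoidAlgebra.single_mul_single, ExteriorAlgebra.ι_sq_zero,
      AddMonoidAlgebra.single_zero, smul_zero]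
  · rw [smul_mul_smul_comm, smul_mul_smul_comm, AddMonoidAlgebra.single_mul_single,
      AddMonoidAlgebra.single_mul_single, mul_comm (entry t.1.1 t.1.2 x), add_comm (root t),
      ← smul_add, ← AddMonoidAlgebra.single_add, ExteriorAlgebra.ι_add_mul_swap,
      AddMonoidAlgebra.single_zero, smul_zero]

/-- The coaction of the group algebra of the weight lattice on the exterior algebra: it sends a
wedge `a` of matrix units to `a ⊗ [weight of a]`. -/
noncomputable def weightCoaction (n : ℕ) : ExteriorAlgebra ℤ (nil n) →ₐ[ℤ]
    AddMonoidAlgebra (ExteriorAlgebra ℤ (nil n)) (Fin n → ℤ) :=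
  ExteriorAlgebra.lift ℤ ⟨gradedι n, gradedι_mul_self⟩

theorem weightCoaction_ιMulti {k : ℕ} (p : Fin k → Pos n) :
    weightCoaction n (ExteriorAlgebra.ιMulti ℤ k fun m => e (p m))
      = AddMonoidAlgebra.single (weight p) (ExteriorAlgebra.ιMulti ℤ k fun m => e (p m)) := by
  induction k with
  | zero =>
    have hweight : weight p = 0 := by ext; simp [weight]
    simp [hweight, AddMonoidAlgebra.one_def]
  | succ k ih =>
    rw [ιMulti_succ', map_mul, ih, weightCoaction, ExteriorAlgebra.lift_ι_apply, gradedι_e,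
      AddMonoidAlgebra.single_mul_single, weight_succ]

/-- The projection of the exterior algebra onto its part of weight `l`: the coefficient of `l` in
the coaction. -/
noncomputable def weightProj (l : Fin n → ℤ) :
    ExteriorAlgebra ℤ (nil n) →ₗ[ℤ] ExteriorAlgebra ℤ (nil n) where
  toFun a := (weightCoaction n a).coeff l
  map_add' a b := by simp
  map_smul' c a := by rw [map_smul, AddMonoidAlgebra.coeff_smul]; rfl

theorem weightProj_ιMulti {k : ℕ} (l : Fin n → ℤ) (p : Fin k → Pos n) :
    weightProj l (ExteriorAlgebra.ιMulti ℤ k fun m => e (p m))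
      = if weight p = l then ExteriorAlgebra.ιMulti ℤ k fun m => e (p m) else 0 := by
  rw [← Finsupp.single_apply, ← AddMonoidAlgebra.coeff_single, ← weightCoaction_ιMulti]
  rfl

theorem weightProj_of_mem {l l' : Fin n → ℤ} {k : ℕ} {a : ExteriorAlgebra ℤ (nil n)}
    (ha : a ∈ weightSpan n l' k) : weightProj l a = if l' = l then a else 0 := by
  split_ifs with hl
  · refine LinearMap.eqOn_span (f := weightProj l) (g := LinearMap.id) ?_ ha
    rintro _ ⟨p, hp, rfl⟩
    exact (weightProj_ιMulti l p).trans (if_pos (hp.trans hl))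
  · refine LinearMap.eqOn_span (f := weightProj l) (g := 0) ?_ ha
    rintro _ ⟨p, hp, rfl⟩
    exact (weightProj_ιMulti l p).trans (if_neg fun h => hl (hp.symm.trans h))

theorem exteriorPower_le_iSup_weightSpan (n k : ℕ) : ⋀[ℤ]^k (nil n) ≤ ⨆ l, weightSpan n l k := by
  rw [← exteriorPower.ιMulti_span_fixedDegree_of_span_eq_top ℤ k (nil n) span_range_e,
    Submodule.span_le]
  rintro _ ⟨x, hx, rfl⟩
  choose p hp using fun m => hx (Set.mem_range_self m)
  obtain rfl : (fun m => e (p m)) = x := funext hp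
  exact Submodule.mem_iSup_of_mem (weight p) (Submodule.subset_span ⟨p, rfl, rfl⟩)

theorem weightProj_mem {l : Fin n → ℤ} {k : ℕ} {a : ExteriorAlgebra ℤ (nil n)}
    (ha : a ∈ ⋀[ℤ]^k (nil n)) : weightProj l a ∈ weightSpan n l k := by
  suffices ⨆ l', weightSpan n l' k ≤ (weightSpan n l k).comap (weightProj l) from
    this (exteriorPower_le_iSup_weightSpan n k ha)
  refine iSup_le fun l' b hb => ?_
  rw [Submodule.mem_comap, weightProj_of_mem hb]
  split_ifs with hl
  · rwa [← hl]
  · exact zero_mem _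

theorem weightProj_boundary {l : Fin n → ℤ} {k : ℕ} {a : ExteriorAlgebra ℤ (nil n)}
    (ha : a ∈ ⋀[ℤ]^(k + 1) (nil n)) :
    weightProj l (boundary ℤ (nil n) a) = boundary ℤ (nil n) (weightProj l a) := by
  suffices ⨆ l', weightSpan n l' (k + 1) ≤ LinearMap.eqLocus
      (weightProj l ∘ₗ boundary ℤ (nil n)) (boundary ℤ (nil n) ∘ₗ weightProj l) from
    this (exteriorPower_le_iSup_weightSpan n (k + 1) ha)
  refine iSup_le fun l' b hb => ?_
  rw [LinearMap.mem_eqLocus, LinearMap.comp_apply, LinearMap.comp_apply, weightProj_of_mem hb,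
    weightProj_of_mem (boundary_mem_weightSpan l' k b hb), apply_ite (boundary ℤ (nil n)), map_zero]

end WeightProjection

section Splitting

variable {R : Type u} {L : Type v} [CommRing R] [LieRing L] [LieAlgebra R L]
  {C D : ℕ → Submodule R (ExteriorAlgebra R L)}
  (hC : ∀ k, ∀ a ∈ C (k + 1), boundary R L a ∈ C k)
  (hD : ∀ k, ∀ a ∈ D (k + 1), boundary R L a ∈ D k)

theorem isSplitMono_complexIncl (hCD : ∀ k, C k ≤ D k)
    (P : ExteriorAlgebra R L →ₗ[R] ExteriorAlgebra R L) (hP : ∀ k, ∀ a ∈ D k, P a ∈ C k)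
    (hPC : ∀ k, ∀ a ∈ C k, P a = a)
    (hPD : ∀ k, ∀ a ∈ D (k + 1), P (boundary R L a) = boundary R L (P a)) :
    IsSplitMono (complexIncl hC hD hCD) := by
  let r : complexOf D hD ⟶ complexOf C hC :=
    ChainComplex.ofHom (X := complexOf D hD) (Y := complexOf C hC)
      (fun k => ModuleCat.ofHom (P.restrict (hP k))) fun k => by
        rw [complexOf_d, complexOf_d]
        exact ModuleCat.hom_ext (LinearMap.ext fun a => Subtype.ext (hPD k a.1 a.2).symm)
  refine ⟨⟨r, ?_⟩⟩
  ext k a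
  exact Subtype.ext (hPC k a.1 a.2)

theorem isSplitMono_bracketIncl {n : ℕ} (w : Fin n → ℤ) : IsSplitMono (bracketIncl w) :=
  isSplitMono_complexIncl _ _ _ (weightProj (unmodify w)) (fun _ _ ha => weightProj_mem ha)
    (fun _ _ ha => (weightProj_of_mem ha).trans (if_pos rfl)) fun _ _ ha => weightProj_boundary ha

end Splitting

end LieHomology

theorem mainTheorem3_general (q n : ℕ) (hq : 0 < q) (hn : q + 2 ≤ n) :
    IsSplitMono (LieHomology.bracketIncl (LieHomology.torsionWeight q n)) ∧
    Nonempty ((LieHomology.bracket (LieHomology.torsionWeight q n)).homology q ≃+ ZMod q) ∧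
    (∀ k : ℕ, k ≠ q →
      Subsingleton ((LieHomology.bracket (LieHomology.torsionWeight q n)).homology k)) ∧
    ∃ A : ModuleCat.{0} ℤ, Nonempty
      ((LieHomology.chevalleyEilenberg ℤ (LieHomology.nil n)).homology q ≃+ ZMod q × A) := by
  have hsplit := LieHomology.isSplitMono_bracketIncl (LieHomology.torsionWeight q n)
  obtain ⟨f⟩ := LieHomology.nonempty_homology_bracket_torsionWeight_addEquiv hq hn
  obtain ⟨A, ⟨g⟩⟩ := LieHomology.exists_nonempty_iso_prod_of_isSplitMono
    ((HomologicalComplex.homologyFunctor (ModuleCat.{0} ℤ) _ q).map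
      (LieHomology.bracketIncl (LieHomology.torsionWeight q n)))
  exact ⟨hsplit, ⟨f⟩,
    fun k hk => LieHomology.subsingleton_homology_bracket_torsionWeight hq hn hk,
    A, ⟨((forget₂ (ModuleCat ℤ) AddCommGrpCat).mapIso g).addCommGroupIsoToAddEquiv.trans
      (f.prodCongr (AddEquiv.refl A))⟩⟩

/-- For a prime power `q ≤ n - 2` and `w = (2, 3, …, q+1, 2, q+1, q+3, …, n)`, the subcomplex `⟦w⟧` of
the Chevalley–Eilenberg complex of `nil_n` is a direct summand, its homology is `ℤ/q` in degree `q`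
and zero in all other degrees, and `H_q(nil_n; ℤ)` has a direct summand `ℤ/q`. -/
theorem mainTheorem3 (q n : ℕ) (hq : IsPrimePow q) (hn : q + 2 ≤ n) :
    IsSplitMono (LieHomology.bracketIncl (LieHomology.torsionWeight q n)) ∧
    Nonempty ((LieHomology.bracket (LieHomology.torsionWeight q n)).homology q ≃+ ZMod q) ∧
    (∀ k : ℕ, k ≠ q →
      Subsingleton ((LieHomology.bracket (LieHomology.torsionWeight q n)).homology k)) ∧
    ∃ A : ModuleCat.{0} ℤ, Nonempty
      ((LieHomology.chevalleyEilenberg ℤ (LieHomology.nil n)).homology q ≃+ ZMod q × A) :=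
  mainTheorem3_general q n hq.pos hn
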